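/- Let $d\ge 1$, let $\Omega\subset\mathbb{R}^d$ be a bounded open set (no regularity of $\partial\Omega$ is needed), let $T>0$, and write $\|\cdot\|_\Omega$, $(\cdot,\cdot)_\Omega$ for the norm and inner product of $L^2(\Omega)$ (scalar or vector valued). Let $H^1_0(\Omega)$ be the closure of $C_0^\infty(\Omega)$ in $H^1(\Omega)$ and $H^{-1}(\Omega)$ its dual, with duality pairing $\langle\cdot,\cdot\rangle$ and norm $\|\Phi\|_{H^{-1}(\Omega)}=\sup_{v\in H^1_0(\Omega)\setminus\{0\}}\langle\Phi,v\rangle/\|\nabla v\|_\Omega$; $L^2(\Omega)$ is embedded in $H^{-1}(\Omega)$ by $\langle w,v\rangle=(w,v)_\Omega$. Let $$X=L^2(0,T;H^1_0(\Omega)),\qquad \|v\|_X^2=\int_0^T\|\nabla v\|_\Omega^2\,dt,\qquad Y=L^2(0,T;H^1_0(\Omega))\cap H^1(0,T;H^{-1}(\Omega)).$$ Values $\varphi(t)\in L^2(\Omega)$, $t\in[0,T]$, of $\varphi\in Y$ are those of its representative in $C([0,T];L^2(\Omega))$. On $Y$ let $$\|\varphi\|_{Y_*}^2=\int_0^T\left(\|\partial_t\varphi\|_{H^{-1}(\Omega)}^2+\|\nabla\varphi\|_\Omega^2\right)dt+\|\varphi(0)\|_\Omega^2+\|\varphi(T)\|_\Omega^2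 ,$$ and for functions $v$ in $X$ with a specified value $v(T)\in L^2(\Omega)$ let $\|v\|_E^2=\tfrac12\|v(T)\|_\Omega^2+\int_0^T\|\nabla v\|_\Omega^2\,dt$. Let $f\in L^2(0,T;H^{-1}(\Omega))$ and $u_0\in H^1_0(\Omega)$, and let $u\in Y$ be the weak solution of the heat equation: $u(0)=u_0$ and, for a.e. $t\in(0,T)$, $\langle\partial_t u(t),v\rangle+(\nabla u(t),\nabla v)_\Omega=\langle f(t),v\rangle$ for all $v\in H^1_0(\Omega)$. Let $N\ge1$, $0=t_0<t_1<\dots<t_N=T$, $\tau_n=t_n-t_{n-1}$, let $f_1,\dots,f_N\in H^{-1}(\Omega)$ be arbitrary, and let $u_1,\dots,u_N\in H^1_0(\Omega)$ be the implicit Euler approximations: $$\left(\frac{u_n-u_{n-1}}{\tau_n},v\right)_\Omega+(\nabla u_n,\nabla v)_\Omega=\langle f_n,v\rangle\qquad\forall v\in H^1_0(\Omega),\ n=1,\dots,N.$$ Let $f_\tau=f_n$ on $(t_{n-1},t_n)$. Let $u_\tau$ be the left-continuous piecewise constant function with $u_\tau=u_n$ on $(t_{n-1},t_n]$ and $u_\tau(0)=u_0$,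 let $U_\tau$ be the continuous piecewise affine function with $U_\tau(t_n)=u_n$ for $n=0,\dots,N$, and put $\overline u_\tau=\tfrac12(u_\tau+U_\tau)$. Define $$\eta_J=\|u_\tau-U_\tau\|_X,\qquad \eta_{\mathrm{osc},\tau,E}=\sup_{\varphi\in Y\setminus\{0\}}\frac{\int_0^T\langle f-f_\tau,\varphi\rangle\,dt}{\|\varphi\|_{Y_*}}$$ (with $\eta_{\mathrm{osc},\tau,E}=0$ if $\Omega=\emptyset$). Then $\eta_{\mathrm{osc},\tau,E}$ is finite and $$\|u-\overline u_\tau\|_E\le\tfrac12\eta_J+\eta_{\mathrm{osc},\tau,E},\qquad \tfrac12\eta_J\le\|u-\overline u_\tau\|_E+\eta_{\mathrm{osc},\tau,E}.$$ -/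

import Mathlib

open MeasureTheory
open scoped ContDiff

namespace HeatEuler

/-- `L²(Ω)`. -/
abbrev L2 {d : ℕ} (Ω : Set (EuclideanSpace ℝ (Fin d))) : Type :=
  Lp ℝ 2 (volume.restrict Ω)

/-- `L²(Ω; ℝ^d)`. -/
abbrev L2Vec {d : ℕ} (Ω : Set (EuclideanSpace ℝ (Fin d))) : Type :=
  Lp (EuclideanSpace ℝ (Fin d)) 2 (volume.restrict Ω)

/-- `C_0^∞(U)`: real-valued smooth functions with compact support contained in `U`. -/
def IsTestFunction {E : Type*} [NormedAddCommGroup E] [NormedSpace ℝ E]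
    (U : Set E) (ψ : E → ℝ) : Prop :=
  ContDiff ℝ ∞ ψ ∧ HasCompactSupport ψ ∧ tsupport ψ ⊆ U

/-- The pairs `(ψ, ∇ψ)`, `ψ ∈ C_0^∞(Ω)`, in the Hilbert space `L²(Ω) × L²(Ω; ℝ^d)` with norm
`(‖v‖² + ‖g‖²)^{1/2}`.  The map `v ↦ (v, ∇v)` identifies `H¹(Ω)`, with its usual norm, with a
closed subspace of this Hilbert space. -/
noncomputable def testGraph {d : ℕ} (Ω : Set (EuclideanSpace ℝ (Fin d))) :
    Submodule ℝ (WithLp 2 (L2 Ω × L2Vec Ω)) where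
  carrier := {p | ∃ ψ : EuclideanSpace ℝ (Fin d) → ℝ, IsTestFunction Ω ψ ∧
    p.fst =ᵐ[volume.restrict Ω] ψ ∧ p.snd =ᵐ[volume.restrict Ω] gradient ψ}
  zero_mem' := by
    refine ⟨0, ⟨contDiff_const, HasCompactSupport.zero, by simp⟩, ?_, ?_⟩
    · exact Lp.coeFn_zero _ _ _
    · refine (Lp.coeFn_zero _ _ _).trans (Filter.Eventually.of_forall fun x => ?_)
      simp [gradient]
  add_mem' := by
    rintro p q ⟨ψ, ⟨h1, h2, h3⟩, h4, h5⟩ ⟨χ, ⟨k1, k2, k3⟩, k4, k5⟩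
    refine ⟨ψ + χ, ⟨h1.add k1, h2.add k2, ?_⟩, ?_, ?_⟩
    · exact (tsupport_add ψ χ).trans (Set.union_subset h3 k3)
    · exact (Lp.coeFn_add _ _).trans (h4.add k4)
    · refine (Lp.coeFn_add _ _).trans ((h5.add k5).trans (Filter.Eventually.of_forall fun x => ?_))
      have a := (h1.differentiable (by simp)).differentiableAt (x := x)
      have b := (k1.differentiable (by simp)).differentiableAt (x := x)
      simp [gradient, fderiv_add a b]
  smul_mem' := by
    rintro c p ⟨ψ, ⟨h1, h2, h3⟩, h4, h5⟩
    refine ⟨c • ψ, ⟨h1.const_smul c, h2.smul_left, ?_⟩, ?_, ?_⟩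
    · exact (closure_mono (Function.support_const_smul_subset c ψ)).trans h3
    · exact (Lp.coeFn_smul _ _).trans (h4.const_smul c)
    · refine (Lp.coeFn_smul _ _).trans
        ((h5.const_smul c).trans (Filter.Eventually.of_forall fun x => ?_))
      have a := (h1.differentiable (by simp)).differentiableAt (x := x)
      simp [gradient, fderiv_const_smul a c]

/-- `H¹_0(Ω)`: the closure of `C_0^∞(Ω)` in `H¹(Ω)`, an element `v` being represented by the
pair `(v, ∇v)`. -/
abbrev H10 {d : ℕ} (Ω : Set (EuclideanSpace ℝ (Fin d))) : Type :=
  (testGraph Ω).topologicalClosure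

/-- The embedding of `H¹_0(Ω)` in `L²(Ω)`. -/
noncomputable def toL2 {d : ℕ} {Ω : Set (EuclideanSpace ℝ (Fin d))} : H10 Ω →L[ℝ] L2 Ω :=
  (WithLp.fstL 2 ℝ (L2 Ω) (L2Vec Ω)).comp (testGraph Ω).topologicalClosure.subtypeL

/-- The weak gradient on `H¹_0(Ω)`. -/
noncomputable def grad {d : ℕ} {Ω : Set (EuclideanSpace ℝ (Fin d))} : H10 Ω →L[ℝ] L2Vec Ω :=
  (WithLp.sndL 2 ℝ (L2 Ω) (L2Vec Ω)).comp (testGraph Ω).topologicalClosure.subtypeL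

/-- `H⁻¹(Ω)`, the dual space of `H¹_0(Ω)`; the pairing `⟨Φ, v⟩` is `Φ v`. -/
abbrev Hneg {d : ℕ} (Ω : Set (EuclideanSpace ℝ (Fin d))) : Type :=
  StrongDual ℝ (H10 Ω)

/-- The norm of `H⁻¹(Ω)` that is dual to `‖∇v‖`: the supremum of `⟨Φ, v⟩ / ‖∇v‖` over `v ≠ 0`. -/
noncomputable def dualNorm {d : ℕ} {Ω : Set (EuclideanSpace ℝ (Fin d))} (Φ : Hneg Ω) : ℝ :=
  sSup {r : ℝ | ∃ v : H10 Ω, v ≠ 0 ∧ r = Φ v / ‖grad v‖}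

/-- The embedding of `L²(Ω)` in `H⁻¹(Ω)`: `⟨w, v⟩ = (w, v)_Ω`. -/
noncomputable def toHneg {d : ℕ} {Ω : Set (EuclideanSpace ℝ (Fin d))} (w : L2 Ω) : Hneg Ω :=
  (innerSL ℝ w).comp toL2

/-- `X = L²(0,T; H¹_0(Ω))` (as a set of classes of functions; its norm in the theory is `normX`
below). -/
abbrev SpaceX {d : ℕ} (Ω : Set (EuclideanSpace ℝ (Fin d))) (T : ℝ) : Type :=
  Lp (H10 Ω) 2 (volume.restrict (Set.Ioo 0 T))

/-- `L²(0,T; H⁻¹(Ω))`. -/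
abbrev L2Hneg {d : ℕ} (Ω : Set (EuclideanSpace ℝ (Fin d))) (T : ℝ) : Type :=
  Lp (Hneg Ω) 2 (volume.restrict (Set.Ioo 0 T))

/-- `w = ∂_t φ` weakly on `(0,T)`, as functions with values in `H⁻¹(Ω)`. -/
def HasWeakTimeDeriv {d : ℕ} {Ω : Set (EuclideanSpace ℝ (Fin d))} {T : ℝ}
    (φ : SpaceX Ω T) (w : L2Hneg Ω T) : Prop :=
  ∀ ψ : ℝ → ℝ, IsTestFunction (Set.Ioo 0 T) ψ →
    ∫ t in Set.Ioo 0 T, deriv ψ t • toHneg (toL2 (φ t)) = -∫ t in Set.Ioo 0 T, ψ t • w t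

/-- `Y = L²(0,T; H¹_0(Ω)) ∩ H¹(0,T; H⁻¹(Ω))`. -/
def SpaceY {d : ℕ} (Ω : Set (EuclideanSpace ℝ (Fin d))) (T : ℝ) : Set (SpaceX Ω T) :=
  {φ | ∃ w : L2Hneg Ω T, HasWeakTimeDeriv φ w}

open Classical in
/-- The weak time derivative `∂_t φ ∈ L²(0,T; H⁻¹(Ω))` of `φ ∈ Y`. -/
noncomputable def timeDeriv {d : ℕ} {Ω : Set (EuclideanSpace ℝ (Fin d))} {T : ℝ}
    (φ : SpaceX Ω T) : L2Hneg Ω T :=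
  if h : ∃ w : L2Hneg Ω T, HasWeakTimeDeriv φ w then h.choose else 0

open Classical in
/-- The value `φ(t) ∈ L²(Ω)`, `t ∈ [0,T]`, of `φ ∈ Y`, read off from the representative of `φ` in
`C([0,T]; L²(Ω))`. -/
noncomputable def valueAt {d : ℕ} {Ω : Set (EuclideanSpace ℝ (Fin d))} {T : ℝ}
    (φ : SpaceX Ω T) : ℝ → L2 Ω :=
  if h : ∃ g : ℝ → L2 Ω, ContinuousOn g (Set.Icc 0 T) ∧
      ∀ᵐ t ∂(volume.restrict (Set.Ioo 0 T)), g t = toL2 (φ t)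
  then h.choose else 0

/-- `‖v‖_X = (∫_0^T ‖∇v‖² dt)^{1/2}`. -/
noncomputable def normX {d : ℕ} {Ω : Set (EuclideanSpace ℝ (Fin d))} (T : ℝ)
    (v : ℝ → H10 Ω) : ℝ :=
  Real.sqrt (∫ t in Set.Ioo 0 T, ‖grad (v t)‖ ^ 2)

/-- The energy norm `(½ ‖v(T)‖² + ∫_0^T ‖∇v‖² dt)^{1/2}` of a function `v` on `(0,T)` whose value
at the final time is `vT ∈ L²(Ω)`. -/
noncomputable def energyNorm {d : ℕ} {Ω : Set (EuclideanSpace ℝ (Fin d))} (T : ℝ)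
    (v : ℝ → H10 Ω) (vT : L2 Ω) : ℝ :=
  Real.sqrt (1 / 2 * ‖vT‖ ^ 2 + ∫ t in Set.Ioo 0 T, ‖grad (v t)‖ ^ 2)

/-- The time-symmetric norm on `Y`:
`(∫_0^T (‖∂_t φ‖²_{H⁻¹} + ‖∇φ‖²) dt + ‖φ(0)‖² + ‖φ(T)‖²)^{1/2}`. -/
noncomputable def normYs {d : ℕ} {Ω : Set (EuclideanSpace ℝ (Fin d))} {T : ℝ}
    (φ : SpaceX Ω T) : ℝ :=
  Real.sqrt ((∫ t in Set.Ioo 0 T, (dualNorm (timeDeriv φ t) ^ 2 + ‖grad (φ t)‖ ^ 2))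
    + ‖valueAt φ 0‖ ^ 2 + ‖valueAt φ T‖ ^ 2)

/-- `u ∈ Y` is the weak solution of `∂_t u - Δu = f` with zero boundary values and `u(0) = u₀`. -/
structure IsWeakSolution {d : ℕ} {Ω : Set (EuclideanSpace ℝ (Fin d))} {T : ℝ}
    (f : L2Hneg Ω T) (u₀ : L2 Ω) (u : SpaceX Ω T) : Prop where
  mem_Y : u ∈ SpaceY Ω T
  equation : ∀ᵐ t ∂(volume.restrict (Set.Ioo 0 T)), ∀ v : H10 Ω,
    timeDeriv u t v + inner ℝ (grad (u t)) (grad v) = f t v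
  initial : valueAt u 0 = u₀

/-- `0 = t_0 < t_1 < ⋯ < t_N = T` with `N ≥ 1` (only `t_0, …, t_N` matter). -/
structure IsTimePartition (T : ℝ) (N : ℕ) (t : ℕ → ℝ) : Prop where
  one_le : 1 ≤ N
  start : t 0 = 0
  finish : t N = T
  lt_succ : ∀ n < N, t n < t (n + 1)

/-- `u_1, …, u_N` are the implicit Euler approximations with sources `f_1, …, f_N`, started at
`u_0`. -/
def IsImplicitEuler {d : ℕ} {Ω : Set (EuclideanSpace ℝ (Fin d))} (N : ℕ) (t : ℕ → ℝ)
    (fn : ℕ → Hneg Ω) (un : ℕ → H10 Ω) : Prop :=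
  ∀ n < N, ∀ v : H10 Ω,
    inner ℝ ((t (n + 1) - t n)⁻¹ • (toL2 (un (n + 1)) - toL2 (un n))) (toL2 v)
      + inner ℝ (grad (un (n + 1))) (grad v) = fn (n + 1) v

/-- `u_τ`: equal to `u_n` on `(t_{n-1}, t_n]` and to `u_0` at `t_0`. -/
noncomputable def constRec {d : ℕ} {Ω : Set (EuclideanSpace ℝ (Fin d))} (N : ℕ) (t : ℕ → ℝ)
    (un : ℕ → H10 Ω) (s : ℝ) : H10 Ω :=
  Set.indicator {t 0} (fun _ => un 0) s +
    ∑ n ∈ Finset.range N, Set.indicator (Set.Ioc (t n) (t (n + 1))) (fun _ => un (n + 1)) s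

/-- `U_τ`: the affine interpolant of `u_{n-1}` and `u_n` on each `(t_{n-1}, t_n]`, equal to `u_0`
at `t_0`. -/
noncomputable def affineRec {d : ℕ} {Ω : Set (EuclideanSpace ℝ (Fin d))} (N : ℕ) (t : ℕ → ℝ)
    (un : ℕ → H10 Ω) (s : ℝ) : H10 Ω :=
  Set.indicator {t 0} (fun _ => un 0) s +
    ∑ n ∈ Finset.range N, Set.indicator (Set.Ioc (t n) (t (n + 1)))
      (fun r => ((r - t n) / (t (n + 1) - t n)) • un (n + 1)
        + ((t (n + 1) - r) / (t (n + 1) - t n)) • un n) s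

/-- The average `½ (u_τ + U_τ)`. -/
noncomputable def averageRec {d : ℕ} {Ω : Set (EuclideanSpace ℝ (Fin d))} (N : ℕ) (t : ℕ → ℝ)
    (un : ℕ → H10 Ω) (s : ℝ) : H10 Ω :=
  (1 / 2 : ℝ) • (constRec N t un s + affineRec N t un s)

/-- `f_τ`: equal to `f_n` on `(t_{n-1}, t_n)`. -/
noncomputable def sourceRec {d : ℕ} {Ω : Set (EuclideanSpace ℝ (Fin d))} (N : ℕ) (t : ℕ → ℝ)
    (fn : ℕ → Hneg Ω) (s : ℝ) : Hneg Ω :=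
  ∑ n ∈ Finset.range N, Set.indicator (Set.Ioo (t n) (t (n + 1))) (fun _ => fn (n + 1)) s

/-- The temporal jump estimator `η_J = ‖u_τ - U_τ‖_X`. -/
noncomputable def etaJ {d : ℕ} {Ω : Set (EuclideanSpace ℝ (Fin d))} (T : ℝ) (N : ℕ) (t : ℕ → ℝ)
    (un : ℕ → H10 Ω) : ℝ :=
  normX T (fun s => constRec N t un s - affineRec N t un s)

/-- The quotients `(∫_0^T ⟨f - f_τ, φ⟩ dt) / ‖φ‖`, `φ ∈ Y \ {0}`, in the time-symmetric norm. -/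
def oscQuotients {d : ℕ} {Ω : Set (EuclideanSpace ℝ (Fin d))} {T : ℝ} (f : L2Hneg Ω T)
    (N : ℕ) (t : ℕ → ℝ) (fn : ℕ → Hneg Ω) : Set ℝ :=
  {r : ℝ | ∃ φ ∈ SpaceY Ω T, φ ≠ 0 ∧
    r = (∫ s in Set.Ioo 0 T, (f s - sourceRec N t fn s) (φ s)) / normYs φ}

/-- The data oscillation `η_{osc,τ,E}`. -/
noncomputable def etaOsc {d : ℕ} {Ω : Set (EuclideanSpace ℝ (Fin d))} {T : ℝ} (f : L2Hneg Ω T)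
    (N : ℕ) (t : ℕ → ℝ) (fn : ℕ → Hneg Ω) : ℝ :=
  sSup (oscQuotients f N t fn)

end HeatEuler

open HeatEuler

/-!
The gradient seminorm is a Hilbert norm on `H¹₀(Ω)` by the Poincaré inequality, so that `H¹₀(Ω)` may
be replaced by a Hilbert space `V` with a compatible map `embL2 ι : V → L²(Ω)` and `H⁻¹(Ω)` by `V`,
through the Riesz map. With `J` that embedding, the operators of the forward and backward heat
equation become `heatOp J (±1) φ = ±J*J φ' + φ` for functions `φ` with values in `V`.

*The residual identity.* Let `e = u - ū_τ` and let `w = u_τ - U_τ`. The scheme says that `U_τ'`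
equals `f_τ + Δu_τ`, and testing the difference to the heat equation with `φ` gives
(`integral_error_identity`)
`∫ ⟪e, heatOp J (-1) φ⟫ + (e(T), φ(T)) = ∫ ⟨f - f_τ, φ⟩ + ½ ∫ ⟪w, heatOp J 1 φ⟫`.
It is the choice of the average of `u_τ` and `U_τ` that makes the backward operator on the left and
the forward operator on the right appear with the same test function.

*The isometries.* Since `2 ∫ ⟪J*J φ', φ⟫ = ‖φ(T)‖² - ‖φ(0)‖²`, the time-symmetric norm satisfies
(`normYs_smoothX_eq_heatOp`)
`‖φ‖²_{Y_*} = ∫ ‖heatOp J 1 φ‖² + 2 ‖φ(0)‖² = ∫ ‖heatOp J (-1) φ‖² + 2 ‖φ(T)‖²`.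
Both terms on the right of the residual identity are therefore at most a multiple of `‖φ‖_{Y_*}`;
and if `φ(0) = 0`, so that `‖φ‖_{Y_*}` is the norm of `heatOp J 1 φ`, the other terms bound the
pairing of `w` with `heatOp J 1 φ` by a multiple of the norm of `heatOp J 1 φ`.

*Duality.* The two estimates follow because the functions `heatOp J σ φ` suffice to recover the
norms of `w` and of `(e, e(T))`
(`sqrt_integral_le_of_heatOp`, `sqrt_half_add_integral_le_of_heatOp`).
For this the range of `heatOp J σ` on the `C¹` functions with zero initial (or final) value has to
be dense in `L²(0,T;V)` (`topologicalClosure_heatRange`). A function orthogonal to the range is a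
very weak solution of a homogeneous heat equation; its primitive in time is regular enough for the energy
identity, and vanishes.

*Values in time.* For `u` in `Y`, the functions `t u(t)` and `(T - t) u(t)` solve a forward and a
backward problem with homogeneous data. By the same density they are limits of `C¹` functions, which
by the energy identity converge uniformly in `L²(Ω)`; the sum of the two limits, divided by `T`, is
the continuous representative of `u` (`exists_continuousOn_representative`).
-/

namespace HeatEuler

/-! ### Primitives and integration by parts on the line -/

lemma memLp_Ioo_of_continuous {F : Type*} [NormedAddCommGroup F] {T : ℝ} {φ : ℝ → F}
    (hφ : Continuous φ) (p : ENNReal) :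
    MemLp φ p (volume.restrict (Set.Ioo 0 T)) := by
  obtain ⟨C, hC⟩ := (isCompact_Icc (a := (0 : ℝ)) (b := T)).exists_bound_of_continuousOn
    hφ.continuousOn
  exact MemLp.of_bound hφ.aestronglyMeasurable C
    ((ae_restrict_mem measurableSet_Ioo).mono fun t ht => hC t ⟨ht.1.le, ht.2.le⟩)

lemma integrable_Ioo_of_continuous {F : Type*} [NormedAddCommGroup F] {T : ℝ} {φ : ℝ → F}
    (hφ : Continuous φ) : Integrable φ (volume.restrict (Set.Ioo 0 T)) :=
  memLp_one_iff_integrable.1 (memLp_Ioo_of_continuous hφ 1)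

/-- The primitive `t ↦ ∫_{(-∞, t]} w dμ`. -/
noncomputable def prim {E : Type*} [NormedAddCommGroup E] [NormedSpace ℝ E] (μ : Measure ℝ)
    (w : ℝ → E) (t : ℝ) : E :=
  ∫ s in Set.Iic t, w s ∂μ

section Prim

variable {E F G : Type*} [NormedAddCommGroup E] [NormedSpace ℝ E]
  [NormedAddCommGroup F] [NormedSpace ℝ F] [NormedAddCommGroup G] [NormedSpace ℝ G]

lemma continuous_prim {μ : Measure ℝ} [NullSingletonClass μ] {w : ℝ → E} (hw : Integrable w μ) :
    Continuous (prim μ w) := by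
  have h : prim μ w = fun t => prim μ w 0 + ∫ s in (0 : ℝ)..t, w s ∂μ := by
    ext t
    rw [← intervalIntegral.integral_Iic_sub_Iic hw.integrableOn hw.integrableOn]
    simp [prim]
  rw [h]
  exact continuous_const.add
    (intervalIntegral.continuous_primitive (fun a b => hw.intervalIntegrable) 0)

variable [CompleteSpace E] [CompleteSpace F] [CompleteSpace G]

/-- Integration by parts in its symmetric form: both sides are the integral of
`b (w s) (q t)` over the square, on the left split along the diagonal. -/
lemma integral_prim_add_integral_prim {μ : Measure ℝ} [SFinite μ] [NullSingletonClass μ]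
    (b : E →L[ℝ] F →L[ℝ] G) {w : ℝ → E} {q : ℝ → F} (hw : Integrable w μ) (hq : Integrable q μ) :
    ∫ t, b (prim μ w t) (q t) ∂μ + ∫ s, b (w s) (prim μ q s) ∂μ
      = b (∫ s, w s ∂μ) (∫ t, q t ∂μ) := by
  have hF : Integrable (fun z : ℝ × ℝ => b (w z.1) (q z.2)) (μ.prod μ) :=
    hw.op_fst_snd (op := fun x y => b x y) (by fun_prop) ⟨‖b‖, b.le_opNorm₂⟩ hq
  have hA : MeasurableSet {z : ℝ × ℝ | z.1 ≤ z.2} := measurableSet_le measurable_fst measurable_snd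
  rw [← integral_prod_bilin b hw hq, ← integral_add_compl hA hF, ← integral_indicator hA,
    ← integral_indicator hA.compl, integral_prod_symm _ (hF.indicator hA),
    integral_prod _ (hF.indicator hA.compl)]
  congr 1
  · refine integral_congr_ae (Filter.Eventually.of_forall fun t => ?_)
    have h1 : ∀ s, Set.indicator {z : ℝ × ℝ | z.1 ≤ z.2} (fun z => b (w z.1) (q z.2)) (s, t)
        = Set.indicator (Set.Iic t) (fun s => b.flip (q t) (w s)) s := by
      intro s; simp [Set.indicator]
    simp only [h1]
    rw [integral_indicator measurableSet_Iic,
      ContinuousLinearMap.integral_comp_comm _ hw.integrableOn]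
    simp [prim]
  · refine integral_congr_ae (Filter.Eventually.of_forall fun s => ?_)
    have h1 : ∀ t, Set.indicator {z : ℝ × ℝ | z.1 ≤ z.2}ᶜ (fun z => b (w z.1) (q z.2)) (s, t)
        = Set.indicator (Set.Iio s) (fun t => b (w s) (q t)) t := by
      intro t; simp [Set.indicator]
    simp only [h1]
    rw [integral_indicator measurableSet_Iio,
      ContinuousLinearMap.integral_comp_comm _ hq.integrableOn,
      Measure.restrict_congr_set Iio_ae_eq_Iic]
    simp [prim]

lemma prim_deriv {T : ℝ} {φ : ℝ → F} (hφ : ContDiff ℝ 1 φ) {t : ℝ} (ht : t ∈ Set.Icc 0 T) :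
    prim (volume.restrict (Set.Ioo 0 T)) (deriv φ) t = φ t - φ 0 := by
  rw [prim, Measure.restrict_restrict measurableSet_Iic,
    ← intervalIntegral.integral_deriv_eq_sub (a := 0) (b := t)
      (fun x _ => hφ.differentiable (by simp) x)
      ((hφ.continuous_deriv le_rfl).intervalIntegrable _ _),
    intervalIntegral.integral_of_le ht.1]
  refine setIntegral_congr_set ?_
  have h : Set.Ioc (0 : ℝ) t =ᵐ[volume] Set.Ioo 0 t := Ioo_ae_eq_Ioc.symm
  have h2 : Set.Iio t ∩ Set.Ioo 0 T = Set.Ioo 0 t := by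
    ext x; simp only [Set.mem_inter_iff, Set.mem_Iio, Set.mem_Ioo]
    constructor
    · rintro ⟨a, b, c⟩; exact ⟨b, a⟩
    · rintro ⟨a, b⟩; exact ⟨b, a, b.trans_le ht.2⟩
  refine Filter.EventuallyEq.trans ?_ h.symm
  rw [← h2]
  exact Iio_ae_eq_Iic.symm.inter (Filter.EventuallyEq.refl _ _)

lemma integral_Ioo_deriv {T : ℝ} (hT : 0 ≤ T) {φ : ℝ → F} (hφ : ContDiff ℝ 1 φ) :
    ∫ t in Set.Ioo 0 T, deriv φ t = φ T - φ 0 := by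
  rw [← integral_Ioc_eq_integral_Ioo, ← intervalIntegral.integral_of_le hT]
  exact intervalIntegral.integral_deriv_eq_sub (fun x _ => hφ.differentiable (by simp) x)
      ((hφ.continuous_deriv le_rfl).intervalIntegrable _ _)

/-- Integration by parts of an absolutely continuous function `c + ∫_0^t w` against a `C¹`
function. -/
lemma integral_const_add_prim_deriv {T : ℝ} (hT : 0 ≤ T) (b : E →L[ℝ] F →L[ℝ] G) {w : ℝ → E}
    (hw : Integrable w (volume.restrict (Set.Ioo 0 T))) (c : E) {φ : ℝ → F}
    (hφ : ContDiff ℝ 1 φ) :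
    ∫ t in Set.Ioo 0 T, (b (c + prim (volume.restrict (Set.Ioo 0 T)) w t) (deriv φ t)
        + b (w t) (φ t))
      = b (c + ∫ s in Set.Ioo 0 T, w s) (φ T) - b c (φ 0) := by
  set μ := volume.restrict (Set.Ioo 0 T) with hμ
  have hφ' : Continuous (deriv φ) := hφ.continuous_deriv le_rfl
  have hi' : Integrable (deriv φ) μ := integrable_Ioo_of_continuous hφ'
  have key := integral_prim_add_integral_prim b hw hi'
  have i1 : Integrable (fun t => b (prim μ w t) (deriv φ t)) μ := by
    apply integrable_Ioo_of_continuous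
    have := continuous_prim hw
    fun_prop
  have i2 : Integrable (fun t => b c (deriv φ t)) μ := (b c).integrable_comp hi'
  have i3 : Integrable (fun t => b (w t) (φ t)) μ := by
    obtain ⟨C, hC⟩ := (isCompact_Icc (a := (0 : ℝ)) (b := T)).exists_bound_of_continuousOn
      hφ.continuous.continuousOn
    refine Integrable.mono' (hw.norm.const_mul (‖b‖ * C))
      (b.aestronglyMeasurable_comp₂ hw.1 hφ.continuous.aestronglyMeasurable) ?_
    filter_upwards [ae_restrict_mem measurableSet_Ioo] with t ht
    refine (b.le_opNorm₂ _ _).trans ?_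
    have := hC t ⟨ht.1.le, ht.2.le⟩
    calc ‖b‖ * ‖w t‖ * ‖φ t‖ ≤ ‖b‖ * ‖w t‖ * C := by gcongr
      _ = _ := by ring
  have e1 : ∫ s, b (w s) (prim μ (deriv φ) s) ∂μ
      = ∫ s, b (w s) (φ s) ∂μ - b (∫ s, w s ∂μ) (φ 0) := by
    rw [show b (∫ s, w s ∂μ) (φ 0) = ∫ s, b.flip (φ 0) (w s) ∂μ by
      rw [ContinuousLinearMap.integral_comp_comm _ hw]; rfl,
      ← integral_sub i3 ((b.flip (φ 0)).integrable_comp hw)]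
    refine integral_congr_ae ?_
    filter_upwards [ae_restrict_mem measurableSet_Ioo] with t ht
    rw [prim_deriv hφ ⟨ht.1.le, ht.2.le⟩]
    simp
  have e2 : ∫ t, deriv φ t ∂μ = φ T - φ 0 := integral_Ioo_deriv hT hφ
  rw [e1, e2] at key
  have e3 : ∫ t, b c (deriv φ t) ∂μ = b c (φ T) - b c (φ 0) := by
    rw [ContinuousLinearMap.integral_comp_comm _ hi', e2, map_sub]
  simp only [map_add, _root_.add_apply]
  rw [integral_add _ i3, integral_add i2 i1, e3]
  · rw [map_sub] at key
    have : ∫ t, b (prim μ w t) (deriv φ t) ∂μ + ∫ t, b (w t) (φ t) ∂μ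
        = b (∫ s, w s ∂μ) (φ T) := by
      have := congrArg (· + b (∫ s, w s ∂μ) (φ 0)) key
      simpa [add_sub_assoc, add_assoc] using this
    rw [add_assoc, this]; abel
  · exact i2.add i1

/-- The fundamental lemma of the calculus of variations on `(0,T)`. -/
lemma ae_eq_zero_of_integral_testFunction_smul {T : ℝ} {g : ℝ → E}
    (hg : Integrable g (volume.restrict (Set.Ioo 0 T)))
    (h : ∀ ψ : ℝ → ℝ, IsTestFunction (Set.Ioo 0 T) ψ → ∫ t in Set.Ioo 0 T, ψ t • g t = 0) :
    ∀ᵐ t ∂(volume.restrict (Set.Ioo 0 T)), g t = 0 := by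
  rw [ae_restrict_iff' measurableSet_Ioo]
  refine isOpen_Ioo.ae_eq_zero_of_integral_contDiff_smul_eq_zero
    (IntegrableOn.locallyIntegrableOn hg) fun ψ h1 h2 h3 => ?_
  rw [← h ψ ⟨h1, h2, h3⟩, setIntegral_eq_integral_of_forall_compl_eq_zero]
  intro t ht
  rw [image_eq_zero_of_notMem_tsupport fun h' => ht (h3 h'), zero_smul]

lemma IsTestFunction.map_boundary {T : ℝ} {ψ : ℝ → ℝ} (hψ : IsTestFunction (Set.Ioo 0 T) ψ) :
    ψ 0 = 0 ∧ ψ T = 0 :=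
  ⟨image_eq_zero_of_notMem_tsupport fun h => lt_irrefl _ (hψ.2.2 h).1,
    image_eq_zero_of_notMem_tsupport fun h => lt_irrefl _ (hψ.2.2 h).2⟩

/-- A test function on `(0,T)` is the derivative of a test function as soon as its integral
vanishes. -/
lemma IsTestFunction.exists_deriv_eq {T : ℝ} (hT : 0 < T) {η : ℝ → ℝ}
    (hη : IsTestFunction (Set.Ioo 0 T) η) (h0 : ∫ t in Set.Ioo 0 T, η t = 0) :
    ∃ ψ : ℝ → ℝ, IsTestFunction (Set.Ioo 0 T) ψ ∧ deriv ψ = η := by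
  by_cases hne : (tsupport η).Nonempty
  swap
  · refine ⟨0, ⟨contDiff_const, HasCompactSupport.zero, by simp⟩, ?_⟩
    have : η = 0 := tsupport_eq_empty_iff.1 (Set.not_nonempty_iff_eq_empty.1 hne)
    rw [this]; ext t; simp
  obtain ⟨a, ha, ha'⟩ := hη.2.1.isCompact.exists_isLeast hne
  obtain ⟨b, hb, hb'⟩ := hη.2.1.isCompact.exists_isGreatest hne
  have hlt : ∀ s, s < a → η s = 0 := fun s hs =>
    image_eq_zero_of_notMem_tsupport fun h => absurd (ha' h) (not_le.2 hs)
  have hgt : ∀ s, b < s → η s = 0 := fun s hs =>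
    image_eq_zero_of_notMem_tsupport fun h => absurd (hb' h) (not_le.2 hs)
  have hc : Continuous η := hη.1.continuous
  have hi : ∀ x y, IntervalIntegrable η volume x y := fun x y => hc.intervalIntegrable x y
  have hd : ∀ t, HasDerivAt (fun t => ∫ s in (0 : ℝ)..t, η s) (η t) t := fun t =>
    intervalIntegral.integral_hasDerivAt_right (hi _ _)
      hc.stronglyMeasurable.stronglyMeasurableAtFilter hc.continuousAt
  have hderiv : deriv (fun t => ∫ s in (0 : ℝ)..t, η s) = η := funext fun t => (hd t).deriv
  have hT0 : ∫ s in (0 : ℝ)..T, η s = 0 := by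
    rw [intervalIntegral.integral_of_le hT.le, integral_Ioc_eq_integral_Ioo, h0]
  have hsupp : Function.support (fun t => ∫ s in (0 : ℝ)..t, η s) ⊆ Set.Icc a b := by
    intro t ht
    by_contra hcon
    refine ht ?_
    rcases lt_or_ge t a with h | h
    · refine intervalIntegral.integral_zero_ae (Filter.Eventually.of_forall fun s hs => hlt s ?_)
      exact (Set.mem_uIoc.1 hs).elim (fun h' => h'.2.trans_lt h)
        (fun h' => h'.2.trans_lt (hη.2.2 ha).1)
    · have h' : b < t := by
        by_contra h''
        exact hcon ⟨h, not_lt.1 h''⟩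
      change ∫ s in (0 : ℝ)..t, η s = 0
      rw [← intervalIntegral.integral_add_adjacent_intervals (hi 0 T) (hi T t), hT0, zero_add]
      refine intervalIntegral.integral_zero_ae (Filter.Eventually.of_forall fun s hs => hgt s ?_)
      exact (Set.mem_uIoc.1 hs).elim (fun h1 => (hη.2.2 hb).2.trans h1.1)
        (fun h1 => h'.trans h1.1)
  have hts : tsupport (fun t => ∫ s in (0 : ℝ)..t, η s) ⊆ Set.Icc a b :=
    closure_minimal hsupp isClosed_Icc
  refine ⟨_, ⟨?_, ?_, hts.trans fun t ht => ⟨(hη.2.2 ha).1.trans_le ht.1,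
    ht.2.trans_lt (hη.2.2 hb).2⟩⟩, hderiv⟩
  · rw [contDiff_infty_iff_deriv, hderiv]
    exact ⟨fun t => (hd t).differentiableAt, hη.1⟩
  · exact HasCompactSupport.intro isCompact_Icc fun t ht => by
      by_contra h; exact ht (hsupp h)

lemma exists_isTestFunction_integral_eq_one {T : ℝ} (hT : 0 < T) :
    ∃ ρ : ℝ → ℝ, IsTestFunction (Set.Ioo 0 T) ρ ∧ ∫ t in Set.Ioo 0 T, ρ t = 1 := by
  let f : ContDiffBump (T / 2) := ⟨T / 8, T / 4, by positivity, by linarith⟩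
  have hs : tsupport (f.normed volume) ⊆ Set.Ioo 0 T := by
    rw [f.tsupport_normed_eq]
    intro x hx
    rw [Metric.mem_closedBall, Real.dist_eq, abs_le] at hx
    have hx1 : -(T / 4) ≤ x - T / 2 ∧ x - T / 2 ≤ T / 4 := hx
    constructor <;> linarith [hx1.1, hx1.2]
  refine ⟨f.normed volume, ⟨f.contDiff_normed, f.hasCompactSupport_normed, hs⟩, ?_⟩
  rw [setIntegral_eq_integral_of_forall_compl_eq_zero, f.integral_normed]
  exact fun t ht => image_eq_zero_of_notMem_tsupport fun h' => ht (hs h')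

/-- A function with integrable weak derivative `w` on `(0,T)` is `c + ∫_0^t w` for a constant
`c`. -/
lemma exists_ae_eq_const_add_prim {T : ℝ} (hT : 0 < T) {g w : ℝ → E}
    (hg : Integrable g (volume.restrict (Set.Ioo 0 T)))
    (hw : Integrable w (volume.restrict (Set.Ioo 0 T)))
    (h : ∀ ψ : ℝ → ℝ, IsTestFunction (Set.Ioo 0 T) ψ →
      ∫ t in Set.Ioo 0 T, deriv ψ t • g t = -∫ t in Set.Ioo 0 T, ψ t • w t) :
    ∃ c : E, ∀ᵐ t ∂(volume.restrict (Set.Ioo 0 T)),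
      g t = c + prim (volume.restrict (Set.Ioo 0 T)) w t := by
  set μ := volume.restrict (Set.Ioo 0 T) with hμ
  have hP : Integrable (prim μ w) μ := integrable_Ioo_of_continuous (continuous_prim hw)
  have hsm : ∀ {ψ : ℝ → ℝ} {k : ℝ → E}, Continuous ψ → Integrable k μ →
      Integrable (fun t => ψ t • k t) μ := fun {ψ k} hψ hk =>
    (hk.smul_of_top_right (memLp_Ioo_of_continuous hψ _))
  have hzero : ∀ ψ : ℝ → ℝ, IsTestFunction (Set.Ioo 0 T) ψ →
      ∫ t, deriv ψ t • (g t - prim μ w t) ∂μ = 0 := by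
    intro ψ hψ
    have h1 := integral_const_add_prim_deriv hT.le (ContinuousLinearMap.lsmul ℝ ℝ).flip hw 0
      (hψ.1.of_le (by simp))
    have hψ' : Continuous (deriv ψ) := hψ.1.continuous_deriv (by simp)
    simp only [zero_add, hψ.map_boundary.1, hψ.map_boundary.2, map_zero, sub_zero,
      ContinuousLinearMap.flip_apply, ContinuousLinearMap.lsmul_apply] at h1
    rw [integral_add (hsm hψ' hP) (hsm hψ.1.continuous hw)] at h1
    simp only [smul_sub]
    rw [integral_sub (hsm hψ' hg) (hsm hψ' hP), h ψ hψ, ← neg_add', neg_eq_zero, add_comm]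
    exact h1
  obtain ⟨ρ, hρ, hρ1⟩ := exists_isTestFunction_integral_eq_one hT
  have hk : Integrable (fun t => g t - prim μ w t) μ := hg.sub hP
  refine ⟨∫ t, ρ t • (g t - prim μ w t) ∂μ, ?_⟩
  set c := ∫ t, ρ t • (g t - prim μ w t) ∂μ with hc
  have := ae_eq_zero_of_integral_testFunction_smul (g := fun t => g t - prim μ w t - c)
    (hk.sub (integrable_const c)) fun η hη => by
      set I := ∫ t, η t ∂μ with hI
      have hηi : Integrable η μ := integrable_Ioo_of_continuous hη.1.continuous
      have hρi : Integrable ρ μ := integrable_Ioo_of_continuous hρ.1.continuous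
      -- `η - (∫ η) ρ` has mean value zero, hence is the derivative of a test function.
      obtain ⟨ψ, hψ, hψη⟩ := IsTestFunction.exists_deriv_eq hT (η := fun t => η t - I * ρ t)
        ⟨hη.1.sub (contDiff_const.mul hρ.1), hη.2.1.sub hρ.2.1.mul_left,
          (tsupport_sub η (fun t => I * ρ t)).trans (Set.union_subset hη.2.2
            ((tsupport_mul_subset_right).trans hρ.2.2))⟩ (by
          rw [integral_sub hηi (hρi.const_mul I), integral_const_mul, hρ1, mul_one, sub_self])
      have h2 := hzero ψ hψ
      rw [hψη] at h2
      simp only [sub_smul, mul_smul] at h2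
      have i2 : Integrable (fun t => I • ρ t • (g t - prim μ w t)) μ :=
        (hsm hρ.1.continuous hk).smul I
      rw [integral_sub (hsm hη.1.continuous hk) i2, integral_smul, ← hc] at h2
      simp only [smul_sub _ _ c]
      rw [integral_sub (hsm hη.1.continuous hk) (hηi.smul_const c), integral_smul_const]
      exact h2
  filter_upwards [this] with t ht
  rw [sub_eq_zero, sub_eq_iff_eq_add] at ht
  exact ht

end Prim

/-! ### Square-integrable functions and reflection in time -/

section SquareIntegrable

variable {α K : Type*} [MeasurableSpace α] {μ : Measure α} [NormedAddCommGroup K]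
  [InnerProductSpace ℝ K] {f g : α → K}

lemma inner_toLp_toLp (hf : MemLp f 2 μ) (hg : MemLp g 2 μ) :
    inner ℝ (hf.toLp f) (hg.toLp g) = ∫ t, inner ℝ (f t) (g t) ∂μ := by
  rw [L2.inner_def]
  refine integral_congr_ae ?_
  filter_upwards [hf.coeFn_toLp, hg.coeFn_toLp] with t h1 h2
  rw [h1, h2]

lemma norm_toLp_sq (hf : MemLp f 2 μ) : ‖hf.toLp f‖ ^ 2 = ∫ t, ‖f t‖ ^ 2 ∂μ := by
  rw [← real_inner_self_eq_norm_sq, inner_toLp_toLp]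
  simp only [real_inner_self_eq_norm_sq]

lemma norm_toLp_eq_sqrt (hf : MemLp f 2 μ) : ‖hf.toLp f‖ = Real.sqrt (∫ t, ‖f t‖ ^ 2 ∂μ) := by
  rw [← norm_toLp_sq, Real.sqrt_sq (norm_nonneg _)]

lemma integral_inner_le_sqrt_mul_sqrt (hf : MemLp f 2 μ) (hg : MemLp g 2 μ) :
    ∫ t, inner ℝ (f t) (g t) ∂μ
      ≤ Real.sqrt (∫ t, ‖f t‖ ^ 2 ∂μ) * Real.sqrt (∫ t, ‖g t‖ ^ 2 ∂μ) := by
  rw [← inner_toLp_toLp hf hg, ← norm_toLp_eq_sqrt hf, ← norm_toLp_eq_sqrt hg]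
  exact real_inner_le_norm _ _

lemma integrable_inner (hf : MemLp f 2 μ) (hg : MemLp g 2 μ) :
    Integrable (fun t => inner ℝ (f t) (g t)) μ := by
  refine (L2.integrable_inner (𝕜 := ℝ) (hf.toLp f) (hg.toLp g)).congr ?_
  filter_upwards [hf.coeFn_toLp, hg.coeFn_toLp] with t h1 h2
  rw [h1, h2]

omit [InnerProductSpace ℝ K] in
lemma integrable_norm_sq (hf : MemLp f 2 μ) : Integrable (fun t => ‖f t‖ ^ 2) μ :=
  hf.integrable_norm_pow (p := 2) (by simp)

omit [InnerProductSpace ℝ K] in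
lemma integrable_of_memLp_two [IsFiniteMeasure μ] (hf : MemLp f 2 μ) : Integrable f μ :=
  hf.integrable (by norm_num)

end SquareIntegrable

lemma measurePreserving_reflect (T : ℝ) :
    MeasurePreserving (fun t => T - t) (volume.restrict (Set.Ioo 0 T))
      (volume.restrict (Set.Ioo 0 T)) := by
  have h := (Measure.measurePreserving_sub_left volume T).restrict_preimage
    (measurableSet_Ioo (a := 0) (b := T))
  simpa using h

lemma integral_reflect {E : Type*} [NormedAddCommGroup E] [NormedSpace ℝ E] (T : ℝ) (f : ℝ → E) :
    ∫ t in Set.Ioo 0 T, f (T - t) = ∫ t in Set.Ioo 0 T, f t :=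
  (measurePreserving_reflect T).integral_comp
    (MeasurableEquiv.subLeft T).measurableEmbedding f

lemma memLp_reflect {E : Type*} [NormedAddCommGroup E] {T : ℝ} {f : ℝ → E} {p : ENNReal}
    (hf : MemLp f p (volume.restrict (Set.Ioo 0 T))) :
    MemLp (fun t => f (T - t)) p (volume.restrict (Set.Ioo 0 T)) :=
  hf.comp_measurePreserving (measurePreserving_reflect T)

lemma ae_reflect {T : ℝ} {P : ℝ → Prop} (h : ∀ᵐ t ∂(volume.restrict (Set.Ioo 0 T)), P t) :
    ∀ᵐ t ∂(volume.restrict (Set.Ioo 0 T)), P (T - t) :=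
  (measurePreserving_reflect T).quasiMeasurePreserving.ae h

lemma contDiff_reflect {E : Type*} [NormedAddCommGroup E] [NormedSpace ℝ E] (T : ℝ) {φ : ℝ → E}
    (hφ : ContDiff ℝ 1 φ) : ContDiff ℝ 1 (fun t => φ (T - t)) :=
  hφ.comp (contDiff_const.sub contDiff_id)

lemma deriv_reflect {E : Type*} [NormedAddCommGroup E] [NormedSpace ℝ E] (T t : ℝ) (φ : ℝ → E) :
    deriv (fun t => φ (T - t)) t = -deriv φ (T - t) :=
  deriv_comp_const_sub ..

/-! ### Weak solvability of the abstract heat equation -/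

section Core

variable {V H : Type*} [NormedAddCommGroup V] [InnerProductSpace ℝ V] [CompleteSpace V]
  [NormedAddCommGroup H] [InnerProductSpace ℝ H] [CompleteSpace H] (J : V →L[ℝ] H)

/-- The operator `J* J`.  If `V` is identified with its dual, this is the embedding
`V → H → V'`. -/
noncomputable def gram : V →L[ℝ] V := (ContinuousLinearMap.adjoint J).comp J

variable (V) in
/-- The inner product as a continuous bilinear form. -/
noncomputable def innerB : V →L[ℝ] V →L[ℝ] ℝ := innerSL ℝ

omit [CompleteSpace V] in
lemma innerB_apply (x y : V) : innerB V x y = inner ℝ x y := rfl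

lemma inner_gram_left (x y : V) : inner ℝ (gram J x) y = inner ℝ (J x) (J y) :=
  (ContinuousLinearMap.adjoint_inner_left J y (J x))

lemma inner_gram_right (x y : V) : inner ℝ x (gram J y) = inner ℝ (J x) (J y) :=
  (ContinuousLinearMap.adjoint_inner_right J x (J y))

/-- The operator of the forward (`σ = 1`) or backward (`σ = -1`) heat equation: the Riesz
representative in `V` of the functional `σ φ' + A φ`, where `A : V → V'` is the Riesz map (`-Δ` in
the application), so that `A φ` is represented by `φ` and `φ'` by `J* J φ'`. -/
noncomputable def heatOp (σ : ℝ) (φ : ℝ → V) (t : ℝ) : V := φ t + σ • gram J (deriv φ t)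

variable {J}

lemma continuous_heatOp (σ : ℝ) {φ : ℝ → V} (hφ : ContDiff ℝ 1 φ) :
    Continuous (heatOp J σ φ) := by
  have := hφ.continuous_deriv le_rfl
  have := hφ.continuous
  unfold heatOp
  fun_prop

lemma memLp_heatOp (σ : ℝ) {φ : ℝ → V} (hφ : ContDiff ℝ 1 φ) (T : ℝ) :
    MemLp (heatOp J σ φ) 2 (volume.restrict (Set.Ioo 0 T)) :=
  memLp_Ioo_of_continuous (continuous_heatOp σ hφ) 2

lemma heatOp_add (σ : ℝ) {φ ψ : ℝ → V} (hφ : ContDiff ℝ 1 φ) (hψ : ContDiff ℝ 1 ψ) (t : ℝ) :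
    heatOp J σ (fun s => φ s + ψ s) t = heatOp J σ φ t + heatOp J σ ψ t := by
  have h : deriv (fun s => φ s + ψ s) t = deriv φ t + deriv ψ t :=
    ((hφ.differentiable one_ne_zero t).hasDerivAt.add
      (hψ.differentiable one_ne_zero t).hasDerivAt).deriv
  rw [heatOp, heatOp, heatOp, h, map_add, smul_add]
  abel

lemma heatOp_const_smul (σ c : ℝ) {φ : ℝ → V} (hφ : ContDiff ℝ 1 φ) (t : ℝ) :
    heatOp J σ (fun s => c • φ s) t = c • heatOp J σ φ t := by
  have h : deriv (fun s => c • φ s) t = c • deriv φ t :=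
    ((hφ.differentiable one_ne_zero t).hasDerivAt.const_smul c).deriv
  rw [heatOp, heatOp, h, map_smul, smul_add, smul_comm σ c]

lemma heatOp_reflect (σ T : ℝ) (φ : ℝ → V) (t : ℝ) :
    heatOp J σ (fun s => φ (T - s)) t = heatOp J (-σ) φ (T - t) := by
  simp [heatOp, deriv_reflect]

/-- Uniqueness of very weak solutions: with `W = ∫_0^t v` the hypothesis says `W + J* J v = 0`,
and testing with `v = W'` gives `½ (‖W‖²)' + ‖J v‖² = 0`. -/
lemma ae_eq_zero_of_integral_heatOp_backward {T : ℝ} (hT : 0 < T) {v : ℝ → V}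
    (hv : MemLp v 2 (volume.restrict (Set.Ioo 0 T)))
    (h : ∀ φ : ℝ → V, ContDiff ℝ 1 φ → φ T = 0 →
      ∫ t in Set.Ioo 0 T, inner ℝ (v t) (heatOp J (-1) φ t) = 0) :
    ∀ᵐ t ∂(volume.restrict (Set.Ioo 0 T)), v t = 0 := by
  set μ := volume.restrict (Set.Ioo 0 T) with hμ
  have hvi : Integrable v μ := integrable_of_memLp_two hv
  set W := prim μ v with hW
  have hWc : Continuous W := continuous_prim hvi
  have hW2 : MemLp W 2 μ := memLp_Ioo_of_continuous hWc 2
  have hgv : MemLp (fun t => gram J (v t)) 2 μ := (gram J).comp_memLp' hv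
  have key : ∀ᵐ t ∂μ, W t + gram J (v t) = 0 := by
    refine ae_eq_zero_of_integral_testFunction_smul
      (integrable_of_memLp_two (hW2.add hgv)) fun q hq => ?_
    have hqc := hq.1.continuous
    refine ext_inner_right ℝ fun x => ?_
    -- The hypothesis is tested with `φ t = (∫_T^t q) x`, so that `φ' = q x` and `φ T = 0`.
    have hp : ∀ t, HasDerivAt (fun t => ∫ s in T..t, q s) (q t) t := fun t =>
      intervalIntegral.integral_hasDerivAt_right (hqc.intervalIntegrable _ _)
        hqc.stronglyMeasurable.stronglyMeasurableAtFilter hqc.continuousAt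
    have hd : ∀ t, HasDerivAt (fun t => (∫ s in T..t, q s) • x) (q t • x) t := fun t =>
      (hp t).smul_const x
    have hdq : deriv (fun t => (∫ s in T..t, q s) • x) = fun t => q t • x :=
      funext fun t => (hd t).deriv
    have hφ : ContDiff ℝ 1 (fun t => (∫ s in T..t, q s) • x) := by
      rw [contDiff_one_iff_deriv, hdq]
      exact ⟨fun t => (hd t).differentiableAt, by fun_prop⟩
    have hφT : (fun t => (∫ s in T..t, q s) • x) T = 0 := by simp
    have h1 := h _ hφ hφT
    have h2 := integral_const_add_prim_deriv hT.le (innerB V) hvi 0 hφ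
    beta_reduce at hφT h2
    rw [hφT] at h2
    simp only [hdq, map_zero, zero_add, _root_.zero_apply, sub_zero, innerB_apply,
      ← hμ, ← hW] at h2
    have hq2 : MemLp (fun t => q t • x) 2 μ := memLp_Ioo_of_continuous (by fun_prop) 2
    have hφ2 : MemLp (fun t => (∫ s in T..t, q s) • x) 2 μ :=
      memLp_Ioo_of_continuous hφ.continuous 2
    rw [integral_add (integrable_inner hW2 hq2) (integrable_inner hv hφ2)] at h2
    simp only [heatOp, hdq, ← sub_eq_add_neg, neg_smul, one_smul, inner_sub_right,
      inner_gram_right, ← inner_gram_left] at h1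
    rw [integral_sub (integrable_inner hv hφ2) (integrable_inner hgv hq2)] at h1
    have h3 : ∫ t, q t • (W t + gram J (v t)) ∂μ
        = ∫ t, q t • W t ∂μ + ∫ t, q t • gram J (v t) ∂μ := by
      simp only [smul_add]
      exact integral_add ((integrable_of_memLp_two hW2).smul_of_top_right
        (memLp_Ioo_of_continuous hqc _)) ((integrable_of_memLp_two hgv).smul_of_top_right
        (memLp_Ioo_of_continuous hqc _))
    have h4 : ∀ k : ℝ → V, Integrable k μ →
        inner ℝ (∫ t, q t • k t ∂μ) x = ∫ t, inner ℝ (k t) (q t • x) ∂μ := fun k hk => by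
      have hi : Integrable (fun t => q t • k t) μ :=
        hk.smul_of_top_right (memLp_Ioo_of_continuous hqc _)
      rw [real_inner_comm, ← integral_inner hi]
      simp only [real_inner_smul_right, real_inner_comm x]
    rw [h3, inner_add_left, inner_zero_left, h4 _ (integrable_of_memLp_two hW2),
      h4 _ (integrable_of_memLp_two hgv)]
    linarith
  have hJ : ∀ᵐ t ∂μ, ‖J (v t)‖ ^ 2 = 0 := by
    have e1 := integral_prim_add_integral_prim (innerB V) hvi hvi
    simp only [innerB_apply, ← hW] at e1
    rw [real_inner_self_eq_norm_sq] at e1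
    have e2 : ∫ t, ‖J (v t)‖ ^ 2 ∂μ = -∫ t, inner ℝ (W t) (v t) ∂μ := by
      rw [← integral_neg]
      refine integral_congr_ae ?_
      filter_upwards [key] with t ht
      rw [← real_inner_self_eq_norm_sq, ← inner_gram_left, eq_neg_of_add_eq_zero_right ht,
        inner_neg_left]
    have e3 : 0 ≤ ∫ t, ‖J (v t)‖ ^ 2 ∂μ := integral_nonneg fun t => by positivity
    have e4 : ∫ t, inner ℝ (v t) (W t) ∂μ = ∫ t, inner ℝ (W t) (v t) ∂μ := by
      simp only [real_inner_comm]
    have e5 : ∫ t, ‖J (v t)‖ ^ 2 ∂μ = 0 := by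
      nlinarith [sq_nonneg ‖∫ s, v s ∂μ‖]
    exact (integral_eq_zero_iff_of_nonneg (fun t => by positivity)
      (integrable_norm_sq (J.comp_memLp' hv))).1 e5
  have hW0 : ∀ᵐ t ∂μ, W t = 0 := by
    filter_upwards [key, hJ] with t h1 h2
    have h3 : J (v t) = 0 := norm_eq_zero.1 (pow_eq_zero_iff (two_ne_zero) |>.1 h2)
    have h4 : gram J (v t) = 0 := by simp [gram, h3]
    rwa [h4, add_zero] at h1
  refine ae_eq_zero_of_integral_testFunction_smul hvi fun ψ hψ => ?_
  have h1 := integral_const_add_prim_deriv hT.le (ContinuousLinearMap.lsmul ℝ ℝ).flip hvi 0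
    (hψ.1.of_le (by simp))
  simp only [zero_add, hψ.map_boundary.1, hψ.map_boundary.2, map_zero, sub_zero,
    ContinuousLinearMap.flip_apply, ContinuousLinearMap.lsmul_apply] at h1
  rw [← h1]
  refine integral_congr_ae ?_
  filter_upwards [hW0] with t ht
  simp only [← hμ, ← hW, ht, smul_zero, zero_add]

lemma ae_eq_zero_of_integral_heatOp_forward {T : ℝ} (hT : 0 < T) {v : ℝ → V}
    (hv : MemLp v 2 (volume.restrict (Set.Ioo 0 T)))
    (h : ∀ φ : ℝ → V, ContDiff ℝ 1 φ → φ 0 = 0 →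
      ∫ t in Set.Ioo 0 T, inner ℝ (v t) (heatOp J 1 φ t) = 0) :
    ∀ᵐ t ∂(volume.restrict (Set.Ioo 0 T)), v t = 0 := by
  have := ae_reflect (ae_eq_zero_of_integral_heatOp_backward (J := J) hT (memLp_reflect hv)
    fun φ hφ hφT => by
      have := h _ (contDiff_reflect T hφ) (by simpa using hφT)
      rw [← integral_reflect] at this
      simpa [heatOp_reflect] using this)
  simpa using this

variable (J) in
/-- The images in `L²(0,T;V)`, under the forward or backward heat operator, of the `C¹` functions
that vanish at time `a`. -/
noncomputable def heatRange (T σ a : ℝ) :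
    Submodule ℝ (Lp V 2 (volume.restrict (Set.Ioo 0 T))) where
  carrier := {p | ∃ φ : ℝ → V, ContDiff ℝ 1 φ ∧ φ a = 0 ∧
    p =ᵐ[volume.restrict (Set.Ioo 0 T)] heatOp J σ φ}
  zero_mem' := by
    refine ⟨0, contDiff_const, rfl, (Lp.coeFn_zero _ _ _).trans
      (Filter.Eventually.of_forall fun t => ?_)⟩
    simp [heatOp]
  add_mem' := by
    rintro p q ⟨φ, h1, h2, h3⟩ ⟨ψ, k1, k2, k3⟩
    refine ⟨fun t => φ t + ψ t, h1.add k1, by simp [h2, k2], ?_⟩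
    exact (Lp.coeFn_add _ _).trans ((h3.add k3).trans
      (Filter.Eventually.of_forall fun t => (heatOp_add σ h1 k1 t).symm))
  smul_mem' := by
    rintro c p ⟨φ, h1, h2, h3⟩
    refine ⟨fun t => c • φ t, h1.const_smul c, by simp [h2], ?_⟩
    exact (Lp.coeFn_smul _ _).trans ((h3.const_smul c).trans
      (Filter.Eventually.of_forall fun t => (heatOp_const_smul σ c h1 t).symm))

/-- The two well-posed problems: forward with an initial value, backward with a final value. -/
def WellPosed (T σ a : ℝ) : Prop := (σ = 1 ∧ a = 0) ∨ (σ = -1 ∧ a = T)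

lemma topologicalClosure_heatRange {T : ℝ} (hT : 0 < T) {σ a : ℝ} (h : WellPosed T σ a) :
    (heatRange J T σ a).topologicalClosure = ⊤ := by
  rw [Submodule.topologicalClosure_eq_top_iff, Submodule.eq_bot_iff]
  intro v hv
  rw [Submodule.mem_orthogonal'] at hv
  have key : ∀ φ : ℝ → V, ContDiff ℝ 1 φ → φ a = 0 →
      ∫ t in Set.Ioo 0 T, inner ℝ (v t) (heatOp J σ φ t) = 0 := fun φ hφ hφa => by
    have := hv _ ⟨φ, hφ, hφa, (memLp_heatOp σ hφ T).coeFn_toLp⟩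
    rw [L2.inner_def] at this
    refine Eq.trans (integral_congr_ae ?_) this
    filter_upwards [(memLp_heatOp (J := J) σ hφ T).coeFn_toLp] with t ht
    rw [ht]
  refine (Lp.eq_zero_iff_ae_eq_zero).2 ?_
  rcases h with ⟨rfl, rfl⟩ | ⟨rfl, rfl⟩
  · exact ae_eq_zero_of_integral_heatOp_forward hT (Lp.memLp v) key
  · exact ae_eq_zero_of_integral_heatOp_backward hT (Lp.memLp v) key

/-- Approximate solvability, with an exact value at the time `a`. -/
lemma exists_heatOp_approx {T : ℝ} (hT : 0 < T) {σ a : ℝ} (h : WellPosed T σ a)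
    (g : Lp V 2 (volume.restrict (Set.Ioo 0 T))) (x : V) {ε : ℝ} (hε : 0 < ε) :
    ∃ (φ : ℝ → V) (hφ : ContDiff ℝ 1 φ), φ a = x ∧
      ‖(memLp_heatOp (J := J) σ hφ T).toLp _ - g‖ < ε := by
  have hx : ContDiff ℝ 1 (fun _ : ℝ => x) := contDiff_const
  have hmem : g - (memLp_heatOp (J := J) σ hx T).toLp _
      ∈ (heatRange J T σ a).topologicalClosure := by
    rw [topologicalClosure_heatRange hT h]; trivial
  rw [← SetLike.mem_coe, Submodule.topologicalClosure_coe, Metric.mem_closure_iff] at hmem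
  obtain ⟨p, ⟨φ, hφ, hφa, hp⟩, hd⟩ := hmem ε hε
  refine ⟨fun t => φ t + x, hφ.add hx, by simp [hφa], ?_⟩
  have hp' : p = (memLp_heatOp (J := J) σ hφ T).toLp _ :=
    Lp.ext (hp.trans (memLp_heatOp (J := J) σ hφ T).coeFn_toLp.symm)
  have e : (memLp_heatOp (J := J) σ (hφ.add hx) T).toLp _
      = p + (memLp_heatOp (J := J) σ hx T).toLp _ := by
    rw [hp', ← MemLp.toLp_add]
    congr 1
    exact funext (heatOp_add σ hφ hx)
  rw [e]
  rw [dist_comm, dist_eq_norm] at hd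
  rwa [sub_sub_eq_add_sub] at hd

end Core

/-! ### Energy identities and the inf-sup estimates -/

section Energy

variable {V H : Type*} [NormedAddCommGroup V] [InnerProductSpace ℝ V] [CompleteSpace V]
  [NormedAddCommGroup H] [InnerProductSpace ℝ H] [CompleteSpace H] {J : V →L[ℝ] H}

lemma inner_heatOp (σ : ℝ) (v : V) (φ : ℝ → V) (t : ℝ) :
    inner ℝ v (heatOp J σ φ t) = inner ℝ v (φ t) + σ * inner ℝ (J v) (J (deriv φ t)) := by
  rw [heatOp, inner_add_right, real_inner_smul_right, inner_gram_right]

omit [CompleteSpace H] in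
lemma integral_inner_deriv_add {T : ℝ} (hT : 0 ≤ T) {φ ψ : ℝ → H} (hφ : ContDiff ℝ 1 φ)
    (hψ : ContDiff ℝ 1 ψ) :
    ∫ t in Set.Ioo 0 T, (inner ℝ (φ t) (deriv ψ t) + inner ℝ (deriv φ t) (ψ t))
      = inner ℝ (φ T) (ψ T) - inner ℝ (φ 0) (ψ 0) := by
  rw [← integral_Ioo_deriv hT (hφ.inner ℝ hψ)]
  refine integral_congr_ae (Filter.Eventually.of_forall fun t => ?_)
  exact (deriv_inner_apply ℝ (hφ.differentiable one_ne_zero t)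
    (hψ.differentiable one_ne_zero t)).symm

omit [CompleteSpace V] [CompleteSpace H] in
lemma contDiff_comp (J : V →L[ℝ] H) {φ : ℝ → V} (hφ : ContDiff ℝ 1 φ) :
    ContDiff ℝ 1 (fun t => J (φ t)) := J.contDiff.comp hφ

omit [CompleteSpace V] [CompleteSpace H] in
lemma deriv_comp_clm (J : V →L[ℝ] H) {φ : ℝ → V} (hφ : ContDiff ℝ 1 φ) (t : ℝ) :
    deriv (fun t => J (φ t)) t = J (deriv φ t) :=
  (J.hasFDerivAt.comp_hasDerivAt t (hφ.differentiable one_ne_zero t).hasDerivAt).deriv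

/-- The energy identity: the cross term `2 σ ⟪φ, J* J φ'⟫` is the derivative of `σ ‖J φ‖²`. -/
lemma integral_norm_heatOp_sq {T : ℝ} (hT : 0 ≤ T) {σ : ℝ} (hσ : σ ^ 2 = 1) {φ : ℝ → V}
    (hφ : ContDiff ℝ 1 φ) :
    ∫ t in Set.Ioo 0 T, ‖heatOp J σ φ t‖ ^ 2
      = (∫ t in Set.Ioo 0 T, (‖gram J (deriv φ t)‖ ^ 2 + ‖φ t‖ ^ 2))
        + σ * (‖J (φ T)‖ ^ 2 - ‖J (φ 0)‖ ^ 2) := by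
  have hc := hφ.continuous
  have hc' := hφ.continuous_deriv le_rfl
  have h := integral_inner_deriv_add hT (contDiff_comp J hφ) (contDiff_comp J hφ)
  simp only [deriv_comp_clm J hφ] at h
  rw [← real_inner_self_eq_norm_sq (J (φ T)), ← real_inner_self_eq_norm_sq (J (φ 0)), ← h,
    ← integral_const_mul, ← integral_add (integrable_Ioo_of_continuous (by fun_prop))
      (integrable_Ioo_of_continuous (by fun_prop))]
  refine integral_congr_ae (Filter.Eventually.of_forall fun t => ?_)
  simp only [heatOp]
  rw [norm_add_sq_real, norm_smul, mul_pow, Real.norm_eq_abs, sq_abs, hσ, real_inner_smul_right,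
    inner_gram_right, real_inner_comm (J (φ t)) (J (deriv φ t))]
  ring

/-- Duality estimate for the forward or backward problem with homogeneous data. -/
lemma sqrt_integral_le_of_heatOp {T : ℝ} (hT : 0 < T) {σ a : ℝ} (h : WellPosed T σ a)
    {z : ℝ → V} (hz : MemLp z 2 (volume.restrict (Set.Ioo 0 T))) {M : ℝ} (hM : 0 ≤ M)
    (hle : ∀ φ : ℝ → V, ContDiff ℝ 1 φ → φ a = 0 →
      ∫ t in Set.Ioo 0 T, inner ℝ (z t) (heatOp J σ φ t)
        ≤ M * Real.sqrt (∫ t in Set.Ioo 0 T, ‖heatOp J σ φ t‖ ^ 2)) :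
    Real.sqrt (∫ t in Set.Ioo 0 T, ‖z t‖ ^ 2) ≤ M := by
  choose φ hφ hφa hlt using fun k : ℕ =>
    exists_heatOp_approx (J := J) hT h (hz.toLp z) 0 (ε := 1 / ((k : ℝ) + 1)) (by positivity)
  have hlim : Filter.Tendsto (fun k => (memLp_heatOp (J := J) σ (hφ k) T).toLp _) Filter.atTop
      (nhds (hz.toLp z)) := by
    rw [tendsto_iff_norm_sub_tendsto_zero]
    exact squeeze_zero (fun k => norm_nonneg _) (fun k => (hlt k).le)
      tendsto_one_div_add_atTop_nhds_zero_nat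
  have hineq : ‖hz.toLp z‖ ^ 2 ≤ M * ‖hz.toLp z‖ := by
    rw [← real_inner_self_eq_norm_sq]
    refine le_of_tendsto_of_tendsto' (tendsto_const_nhds.inner hlim) (hlim.norm.const_mul M)
      fun k => ?_
    rw [inner_toLp_toLp, norm_toLp_eq_sqrt]
    exact hle _ (hφ k) (hφa k)
  rw [← norm_toLp_eq_sqrt hz]
  nlinarith [norm_nonneg (hz.toLp z)]

/-- Duality estimate for the backward problem with free final values.  The isometry
`φ ↦ (φ - J* J φ', √2 J φ(T))` turns the pairing with `(z, h)` into an inner product. -/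
lemma sqrt_half_add_integral_le_of_heatOp {T : ℝ} (hT : 0 < T) {z : ℝ → V}
    (hz : MemLp z 2 (volume.restrict (Set.Ioo 0 T))) {h : H} (hh : h ∈ closure (Set.range J))
    {M : ℝ} (hM : 0 ≤ M)
    (hle : ∀ φ : ℝ → V, ContDiff ℝ 1 φ →
      (∫ t in Set.Ioo 0 T, inner ℝ (z t) (heatOp J (-1) φ t)) + inner ℝ h (J (φ T))
        ≤ M * Real.sqrt ((∫ t in Set.Ioo 0 T, ‖heatOp J (-1) φ t‖ ^ 2) + 2 * ‖J (φ T)‖ ^ 2)) :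
    Real.sqrt (1 / 2 * ‖h‖ ^ 2 + ∫ t in Set.Ioo 0 T, ‖z t‖ ^ 2) ≤ M := by
  -- The supremum is attained where `φ - J* J φ' = z` and `√2 J (φ T) = h / √2`; hence `h / 2` as
  -- the approximate final value.
  obtain ⟨y, hy, hylim⟩ := mem_closure_iff_seq_limit.1 hh
  choose x hx using hy
  choose φ hφ hφa hlt using fun k : ℕ =>
    exists_heatOp_approx (J := J) hT (Or.inr ⟨rfl, rfl⟩) (hz.toLp z) ((1 / 2 : ℝ) • x k)
      (ε := 1 / ((k : ℝ) + 1)) (by positivity)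
  have hlim : Filter.Tendsto (fun k => (memLp_heatOp (J := J) (-1) (hφ k) T).toLp _) Filter.atTop
      (nhds (hz.toLp z)) := by
    rw [tendsto_iff_norm_sub_tendsto_zero]
    exact squeeze_zero (fun k => norm_nonneg _) (fun k => (hlt k).le)
      tendsto_one_div_add_atTop_nhds_zero_nat
  have hlim2 : Filter.Tendsto (fun k => J (φ k T)) Filter.atTop (nhds ((1 / 2 : ℝ) • h)) := by
    simp only [hφa, map_smul, hx]
    exact hylim.const_smul _
  set S := 1 / 2 * ‖h‖ ^ 2 + ∫ t in Set.Ioo 0 T, ‖z t‖ ^ 2 with hS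
  have hS0 : 0 ≤ S := by
    have : 0 ≤ ∫ t in Set.Ioo 0 T, ‖z t‖ ^ 2 := integral_nonneg fun t => by positivity
    positivity
  have hineq : S ≤ M * Real.sqrt S := by
    have h1 : S = inner ℝ (hz.toLp z) (hz.toLp z) + inner ℝ h ((1 / 2 : ℝ) • h) := by
      rw [real_inner_self_eq_norm_sq, norm_toLp_sq, real_inner_smul_right,
        real_inner_self_eq_norm_sq]
      ring
    have h2 : S = ‖hz.toLp z‖ ^ 2 + 2 * ‖(1 / 2 : ℝ) • h‖ ^ 2 := by
      rw [norm_toLp_sq, norm_smul, mul_pow, Real.norm_eq_abs, sq_abs]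
      ring
    have h3 : M * Real.sqrt S = M * Real.sqrt (‖hz.toLp z‖ ^ 2 + 2 * ‖(1 / 2 : ℝ) • h‖ ^ 2) := by
      rw [← h2]
    rw [h3, h1]
    refine le_of_tendsto_of_tendsto' ((tendsto_const_nhds.inner hlim).add
      (tendsto_const_nhds.inner hlim2)) ((((hlim.norm.pow 2).add
        ((hlim2.norm.pow 2).const_mul 2)).sqrt).const_mul M) fun k => ?_
    rw [inner_toLp_toLp, norm_toLp_sq]
    exact hle _ (hφ k)
  have h4 := Real.mul_self_sqrt hS0
  have h5 := Real.sqrt_nonneg S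
  nlinarith

/-! ### Continuous representatives -/

/-- A very weak solution of `z + J* J z' = g`, `J z(0) = 0` is a limit of `C¹` functions that
converge uniformly in `H` by the energy identity. -/
lemma exists_continuousOn_of_forward {T : ℝ} (hT : 0 < T) {z g : ℝ → V}
    (hz : MemLp z 2 (volume.restrict (Set.Ioo 0 T)))
    (hg : MemLp g 2 (volume.restrict (Set.Ioo 0 T)))
    (h : ∀ ψ : ℝ → V, ContDiff ℝ 1 ψ → ψ T = 0 →
      ∫ t in Set.Ioo 0 T, inner ℝ (z t) (heatOp J (-1) ψ t)
        = ∫ t in Set.Ioo 0 T, inner ℝ (g t) (ψ t)) :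
    ∃ y : ℝ → H, ContinuousOn y (Set.Icc 0 T) ∧
      ∀ᵐ t ∂(volume.restrict (Set.Ioo 0 T)), y t = J (z t) := by
  set μ := volume.restrict (Set.Ioo 0 T) with hμ
  choose φ hφ hφ0 hlt using fun k : ℕ =>
    exists_heatOp_approx (J := J) hT (Or.inl ⟨rfl, rfl⟩) (hg.toLp g) 0
      (ε := 1 / ((k : ℝ) + 1)) (by positivity)
  have hlim : Filter.Tendsto (fun k => (memLp_heatOp (J := J) 1 (hφ k) T).toLp _) Filter.atTop
      (nhds (hg.toLp g)) := by
    rw [tendsto_iff_norm_sub_tendsto_zero]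
    exact squeeze_zero (fun k => norm_nonneg _) (fun k => (hlt k).le)
      tendsto_one_div_add_atTop_nhds_zero_nat
  have hφ2 : ∀ k, MemLp (φ k) 2 μ := fun k => memLp_Ioo_of_continuous (hφ k).continuous 2
  -- The error of the solutions is controlled by the error of the right-hand sides, by duality
  -- with the backward problem.
  have hsol : ∀ k, ‖(hφ2 k).toLp _ - hz.toLp z‖
      ≤ ‖(memLp_heatOp (J := J) 1 (hφ k) T).toLp _ - hg.toLp g‖ := by
    intro k
    rw [norm_sub_rev, norm_sub_rev _ (hg.toLp g), ← MemLp.toLp_sub, ← MemLp.toLp_sub,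
      norm_toLp_eq_sqrt, norm_toLp_eq_sqrt]
    refine sqrt_integral_le_of_heatOp (J := J) hT (Or.inr ⟨rfl, rfl⟩) (hz.sub (hφ2 k))
      (Real.sqrt_nonneg _) fun ψ hψ hψT => ?_
    have hψ2 : MemLp ψ 2 μ := memLp_Ioo_of_continuous hψ.continuous 2
    have e1 : ∫ t in Set.Ioo 0 T, inner ℝ ((z - φ k) t) (heatOp J (-1) ψ t)
        = ∫ t in Set.Ioo 0 T, inner ℝ ((g - heatOp J 1 (φ k)) t) (ψ t) := by
      simp only [Pi.sub_apply, inner_sub_left]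
      rw [integral_sub (integrable_inner hz (memLp_heatOp _ hψ T))
        (integrable_inner (hφ2 k) (memLp_heatOp _ hψ T)), h ψ hψ hψT,
        integral_sub (integrable_inner hg hψ2)
        (integrable_inner (memLp_heatOp _ (hφ k) T) hψ2)]
      congr 1
      rw [← sub_eq_zero, ← integral_sub (integrable_inner (hφ2 k) (memLp_heatOp _ hψ T))
        (integrable_inner (memLp_heatOp _ (hφ k) T) hψ2), ← neg_eq_zero, ← integral_neg]
      have e2 := integral_inner_deriv_add hT.le (contDiff_comp J (hφ k)) (contDiff_comp J hψ)
      simp only [deriv_comp_clm J hψ, deriv_comp_clm J (hφ k), hψT, hφ0 k, map_zero,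
        inner_zero_left, inner_zero_right, sub_zero] at e2
      rw [← e2]
      refine integral_congr_ae (Filter.Eventually.of_forall fun t => ?_)
      simp only
      rw [real_inner_comm (ψ t) (heatOp J 1 (φ k) t), inner_heatOp, inner_heatOp,
        real_inner_comm (J (deriv (φ k) t)), real_inner_comm (φ k t)]
      ring
    rw [e1]
    refine (integral_inner_le_sqrt_mul_sqrt (hg.sub (memLp_heatOp 1 (hφ k) T)) hψ2).trans ?_
    refine mul_le_mul_of_nonneg_left (Real.sqrt_le_sqrt ?_) (Real.sqrt_nonneg _)
    rw [integral_norm_heatOp_sq hT.le (by norm_num) hψ, hψT, map_zero, norm_zero]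
    have : ∫ t in Set.Ioo 0 T, ‖ψ t‖ ^ 2
        ≤ ∫ t in Set.Ioo 0 T, (‖gram J (deriv ψ t)‖ ^ 2 + ‖ψ t‖ ^ 2) := by
      have hc := hψ.continuous
      have hc' := hψ.continuous_deriv le_rfl
      refine integral_mono (integrable_Ioo_of_continuous (by fun_prop))
        (integrable_Ioo_of_continuous (by fun_prop)) fun t => ?_
      simp only
      linarith [sq_nonneg ‖gram J (deriv ψ t)‖]
    refine this.trans ?_
    have := sq_nonneg ‖J (ψ 0)‖
    linarith
  have hlimφ : Filter.Tendsto (fun k => (hφ2 k).toLp _) Filter.atTop (nhds (hz.toLp z)) := by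
    rw [tendsto_iff_norm_sub_tendsto_zero]
    exact squeeze_zero (fun k => norm_nonneg _) (fun k => (hsol k).trans (hlt k).le)
      tendsto_one_div_add_atTop_nhds_zero_nat
  -- Uniform Cauchy property in `H`.
  have hunif : ∀ k l, ∀ t ∈ Set.Icc 0 T, dist (J (φ k t)) (J (φ l t))
      ≤ dist ((memLp_heatOp (J := J) 1 (hφ k) T).toLp _)
        ((memLp_heatOp (J := J) 1 (hφ l) T).toLp _) := by
    intro k l t ht
    have hd : ContDiff ℝ 1 (fun s => φ k s + (-1 : ℝ) • φ l s) :=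
      (hφ k).add ((hφ l).const_smul _)
    have e1 := integral_norm_heatOp_sq (J := J) ht.1 (σ := 1) (by norm_num) hd
    have e2 : ∀ s, heatOp J 1 (fun s => φ k s + (-1 : ℝ) • φ l s) s
        = heatOp J 1 (φ k) s - heatOp J 1 (φ l) s := fun s => by
      rw [heatOp_add 1 (hφ k) ((hφ l).const_smul _), heatOp_const_smul 1 (-1) (hφ l)]
      simp [sub_eq_add_neg]
    have e3 : 0 ≤ ∫ s in Set.Ioo 0 t, (‖gram J (deriv (fun s => φ k s + (-1 : ℝ) • φ l s) s)‖ ^ 2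
        + ‖φ k s + (-1 : ℝ) • φ l s‖ ^ 2) := integral_nonneg fun s => by positivity
    have e4 : ∫ s in Set.Ioo 0 t, ‖heatOp J 1 (fun s => φ k s + (-1 : ℝ) • φ l s) s‖ ^ 2
        ≤ ∫ s in Set.Ioo 0 T, ‖heatOp J 1 (fun s => φ k s + (-1 : ℝ) • φ l s) s‖ ^ 2 :=
      setIntegral_mono_set (integrable_norm_sq (memLp_heatOp 1 hd T))
        (Filter.Eventually.of_forall fun s => by positivity)
        (Set.Ioo_subset_Ioo_right ht.2).eventuallyLE
    rw [dist_eq_norm, dist_eq_norm, ← MemLp.toLp_sub, norm_toLp_eq_sqrt]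
    refine Real.le_sqrt_of_sq_le ?_
    simp only [e2] at e4
    refine le_trans ?_ e4
    simp only [e2] at e1
    rw [e1, hφ0, hφ0]
    simp only [neg_smul, one_smul, ← sub_eq_add_neg, map_sub] at e3 ⊢
    simp only [sub_self, map_zero, norm_zero, ne_eq, OfNat.ofNat_ne_zero, not_false_eq_true,
      zero_pow, sub_zero, one_mul]
    linarith
  have hcau : UniformCauchySeqOn (fun k t => J (φ k t)) Filter.atTop (Set.Icc 0 T) := by
    rw [Metric.uniformCauchySeqOn_iff]
    intro ε hε
    obtain ⟨N, hN⟩ := Metric.cauchySeq_iff.1 hlim.cauchySeq ε hε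
    exact ⟨N, fun m hm n hn t ht => (hunif m n t ht).trans_lt (hN m hm n hn)⟩
  have hpt : ∀ t, ∃ y : H, t ∈ Set.Icc 0 T →
      Filter.Tendsto (fun k => J (φ k t)) Filter.atTop (nhds y) := fun t => by
    by_cases ht : t ∈ Set.Icc 0 T
    · obtain ⟨y, hy⟩ := cauchySeq_tendsto_of_complete (hcau.cauchySeq ht)
      exact ⟨y, fun _ => hy⟩
    · exact ⟨0, fun h' => absurd h' ht⟩
  choose y hy using hpt
  refine ⟨y, (hcau.tendstoUniformlyOn_of_tendsto fun t ht => hy t ht).continuousOn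
    (Filter.Eventually.of_forall fun k =>
      (J.continuous.comp (hφ k).continuous).continuousOn).frequently, ?_⟩
  obtain ⟨ns, hns, hae⟩ := (tendstoInMeasure_of_tendsto_Lp hlimφ).exists_seq_tendsto_ae
  have hall : ∀ᵐ t ∂μ, ∀ k, (hφ2 k).toLp _ t = φ k t :=
    ae_all_iff.2 fun k => (hφ2 k).coeFn_toLp
  filter_upwards [hae, hall, hz.coeFn_toLp, ae_restrict_mem measurableSet_Ioo]
    with t h1 h2 h3 h4
  simp only [h2, h3] at h1
  exact tendsto_nhds_unique ((hy t ⟨h4.1.le, h4.2.le⟩).comp hns.tendsto_atTop)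
    ((J.continuous.tendsto _).comp h1)

omit [CompleteSpace V] in
lemma memLp_smul_Ioo {T : ℝ} {v : ℝ → V} {p : ℝ → ℝ} (hp : Continuous p)
    (hv : MemLp v 2 (volume.restrict (Set.Ioo 0 T))) :
    MemLp (fun t => p t • v t) 2 (volume.restrict (Set.Ioo 0 T)) :=
  hv.smul (r := 2) (p := ⊤) (q := 2) (memLp_Ioo_of_continuous hp ⊤)

/-- The part `t u(t)`, which solves a forward problem with homogeneous initial value. -/
lemma exists_continuousOn_smul_id {T : ℝ} (hT : 0 < T) {u w : ℝ → V}
    (hu : MemLp u 2 (volume.restrict (Set.Ioo 0 T)))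
    (hw : MemLp w 2 (volume.restrict (Set.Ioo 0 T)))
    (h : ∀ ψ : ℝ → V, ContDiff ℝ 1 ψ → ψ 0 = 0 → ψ T = 0 →
      ∫ t in Set.Ioo 0 T, (inner ℝ (gram J (u t)) (deriv ψ t) + inner ℝ (w t) (ψ t)) = 0) :
    ∃ y : ℝ → H, ContinuousOn y (Set.Icc 0 T) ∧
      ∀ᵐ t ∂(volume.restrict (Set.Ioo 0 T)), y t = t • J (u t) := by
  have htu : MemLp (fun t => t • u t) 2 (volume.restrict (Set.Ioo 0 T)) :=
    memLp_smul_Ioo continuous_id hu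
  have htw : MemLp (fun t => t • w t) 2 (volume.restrict (Set.Ioo 0 T)) :=
    memLp_smul_Ioo continuous_id hw
  have hg : MemLp (fun t => t • u t + t • w t + gram J (u t)) 2
      (volume.restrict (Set.Ioo 0 T)) := (htu.add htw).add ((gram J).comp_memLp' hu)
  obtain ⟨y, hy, hyu⟩ := exists_continuousOn_of_forward (J := J) hT
    (z := fun t => t • u t) (g := fun t => t • u t + t • w t + gram J (u t)) htu
    hg fun ψ hψ hψT => by
      have hψ2 : MemLp ψ 2 (volume.restrict (Set.Ioo 0 T)) :=
        memLp_Ioo_of_continuous hψ.continuous 2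
      rw [← sub_eq_zero, ← integral_sub (integrable_inner htu (memLp_heatOp _ hψ T))
        (integrable_inner hg hψ2), ← neg_eq_zero, ← integral_neg]
      refine Eq.trans ?_ (h (fun t => t • ψ t) (contDiff_id.smul hψ) (by simp) (by simp [hψT]))
      refine integral_congr_ae (Filter.Eventually.of_forall fun t => ?_)
      have hd : deriv (fun t => t • ψ t) t = t • deriv ψ t + ψ t := by
        have hd' : HasDerivAt (fun t => t • ψ t) (t • deriv ψ t + (1 : ℝ) • ψ t) t :=
          (hasDerivAt_id t).smul (hψ.differentiable one_ne_zero t).hasDerivAt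
        rw [hd'.deriv, one_smul]
      simp only [hd, inner_heatOp, inner_add_left, inner_add_right,
        real_inner_smul_left, real_inner_smul_right, map_smul, inner_gram_left]
      ring
  exact ⟨y, hy, hyu.mono fun t ht => by rw [ht, map_smul]⟩

/-- A function in `L²(0,T;V)` whose weak derivative lies in `L²(0,T;V')` has a representative in
`C([0,T];H)`: `t u(t)` is treated forward and `(T - t) u(t)` backward in time. -/
lemma exists_continuousOn_representative {T : ℝ} (hT : 0 < T) {u w : ℝ → V}
    (hu : MemLp u 2 (volume.restrict (Set.Ioo 0 T)))
    (hw : MemLp w 2 (volume.restrict (Set.Ioo 0 T)))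
    (h : ∀ ψ : ℝ → V, ContDiff ℝ 1 ψ → ψ 0 = 0 → ψ T = 0 →
      ∫ t in Set.Ioo 0 T, (inner ℝ (gram J (u t)) (deriv ψ t) + inner ℝ (w t) (ψ t)) = 0) :
    ∃ y : ℝ → H, ContinuousOn y (Set.Icc 0 T) ∧
      ∀ᵐ t ∂(volume.restrict (Set.Ioo 0 T)), y t = J (u t) := by
  obtain ⟨y₁, hy₁, hyu₁⟩ := exists_continuousOn_smul_id (J := J) hT hu hw h
  obtain ⟨y₂, hy₂, hyu₂⟩ := exists_continuousOn_smul_id (J := J) hT (memLp_reflect hu)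
    (w := fun t => -w (T - t)) (memLp_reflect hw).neg fun ψ hψ h0 hT0 => by
      rw [← neg_eq_zero, ← integral_neg]
      refine Eq.trans ?_ (h (fun t => ψ (T - t)) (contDiff_reflect T hψ)
        (by simpa using hT0) (by simpa using h0))
      rw [← integral_reflect T fun t => inner ℝ (gram J (u t)) _ + _]
      refine integral_congr_ae (Filter.Eventually.of_forall fun t => ?_)
      simp only [deriv_reflect, inner_neg_left, inner_neg_right, sub_sub_cancel]
      ring
  refine ⟨fun t => T⁻¹ • (y₁ t + y₂ (T - t)), ?_, ?_⟩
  · refine (hy₁.add (hy₂.comp (by fun_prop) fun t ht => ?_)).const_smul _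
    exact ⟨by linarith [ht.2], by linarith [ht.1]⟩
  · filter_upwards [hyu₁, ae_reflect hyu₂] with t h1 h2
    rw [h1, h2, sub_sub_cancel, ← add_smul, add_sub_cancel, inv_smul_smul₀ hT.ne']

end Energy

/-! ### The Poincaré inequality and the gradient inner product -/

section Poincare

variable {d : ℕ} {Ω : Set (EuclideanSpace ℝ (Fin d))}

/-- Poincaré's inequality for test functions: integrate `∂ᵢ(xᵢ ψ²) = ψ² + 2 xᵢ ψ ∂ᵢψ`. -/
lemma integral_sq_le_integral_norm_gradient_sq (i : Fin d) {R : ℝ}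
    (hR : ∀ x ∈ Ω, ‖x‖ ≤ R) {ψ : EuclideanSpace ℝ (Fin d) → ℝ} (hψ : IsTestFunction Ω ψ) :
    ∫ x, ‖ψ x‖ ^ 2 ≤ 4 * R ^ 2 * ∫ x, ‖gradient ψ x‖ ^ 2 := by
  obtain ⟨hs, hc, hsub⟩ := hψ
  set e : EuclideanSpace ℝ (Fin d) := EuclideanSpace.single i 1 with he
  have hψc := hs.continuous
  have hd : Differentiable ℝ ψ := hs.differentiable (by simp)
  have hfd : Continuous (fderiv ℝ ψ) := hs.continuous_fderiv (by simp)
  have hgrad : Continuous (gradient ψ) := by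
    unfold gradient
    exact (InnerProductSpace.toDual ℝ _).symm.continuous.comp hfd
  have hgradc : HasCompactSupport (gradient ψ) := by
    refine (hc.fderiv (𝕜 := ℝ)).comp_left (g := (InnerProductSpace.toDual ℝ _).symm) (map_zero _)
  have hf : ∀ x, HasFDerivAt (fun x => ψ x ^ 2) ((2 * ψ x) • fderiv ℝ ψ x) x := fun x => by
    simpa using (hd x).hasFDerivAt.pow 2
  have hf' : ∀ x, fderiv ℝ (fun x => ψ x ^ 2) x e = 2 * ψ x * fderiv ℝ ψ x e := fun x => by
    rw [(hf x).fderiv]; simp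
  have hg : ∀ x, fderiv ℝ (fun x : EuclideanSpace ℝ (Fin d) => x i) x e = 1 := fun x => by
    have : HasFDerivAt (fun x : EuclideanSpace ℝ (Fin d) => x i)
      (EuclideanSpace.proj i : EuclideanSpace ℝ (Fin d) →L[ℝ] ℝ) x :=
      (EuclideanSpace.proj i : EuclideanSpace ℝ (Fin d) →L[ℝ] ℝ).hasFDerivAt
    rw [this.fderiv]; simp [he]
  have hxi : Differentiable ℝ (fun x : EuclideanSpace ℝ (Fin d) => x i) :=
    (EuclideanSpace.proj i : EuclideanSpace ℝ (Fin d) →L[ℝ] ℝ).differentiable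
  have i1 : Integrable (fun x => ‖ψ x‖ ^ 2) :=
    (by fun_prop : Continuous (fun x => ‖ψ x‖ ^ 2)).integrable_of_hasCompactSupport
      (hc.comp_left (g := fun y => ‖y‖ ^ 2) (by simp))
  have i2 : Integrable (fun x => ‖gradient ψ x‖ ^ 2) :=
    (by fun_prop : Continuous (fun x => ‖gradient ψ x‖ ^ 2)).integrable_of_hasCompactSupport
      (hgradc.comp_left (g := fun y => ‖y‖ ^ 2) (by simp))
  have i3 : Integrable (fun x => 2 * ψ x * fderiv ℝ ψ x e * x i) := by
    refine (by fun_prop : Continuous _).integrable_of_hasCompactSupport ?_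
    exact ((hc.mul_left (f := fun _ => (2 : ℝ))).mul_right).mul_right
  have key : ∫ x, ψ x ^ 2 = -∫ x, 2 * ψ x * fderiv ℝ ψ x e * x i := by
    have := integral_mul_fderiv_eq_neg_fderiv_mul_of_integrable (μ := volume)
      (f := fun x => ψ x ^ 2) (g := fun x : EuclideanSpace ℝ (Fin d) => x i) (v := e)
      (by simpa only [hf'] using i3)
      (by simpa only [hg, mul_one, Real.norm_eq_abs, sq_abs] using i1)
      ((by fun_prop : Continuous fun x : EuclideanSpace ℝ (Fin d) =>
          ψ x ^ 2 * x i).integrable_of_hasCompactSupport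
        ((hc.comp_left (g := fun y => y ^ 2) (by simp)).mul_right))
      (fun x _ => (hf x).differentiableAt) (fun x _ => hxi x)
    simpa only [hf', hg, mul_one] using this
  have hbound : ∀ x, -(2 * ψ x * fderiv ℝ ψ x e * x i)
      ≤ 1 / 2 * ‖ψ x‖ ^ 2 + 2 * R ^ 2 * ‖gradient ψ x‖ ^ 2 := by
    intro x
    by_cases hx : x ∈ Ω
    · have h1 : |fderiv ℝ ψ x e| ≤ ‖gradient ψ x‖ := by
        have h2 : ‖gradient ψ x‖ = ‖fderiv ℝ ψ x‖ := by simp [gradient]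
        have h3 := (fderiv ℝ ψ x).le_opNorm e
        have h4 : ‖e‖ = 1 := by simp [he]
        rwa [h4, mul_one, ← h2] at h3
      have h5 : |x i| ≤ R := (PiLp.norm_apply_le x i).trans (hR x hx)
      have h6 : |fderiv ℝ ψ x e * x i| ≤ ‖gradient ψ x‖ * R := by
        rw [abs_mul]
        exact mul_le_mul h1 h5 (abs_nonneg _) (norm_nonneg _)
      have h7 : -(2 * ψ x * fderiv ℝ ψ x e * x i) ≤ 2 * ‖ψ x‖ * (‖gradient ψ x‖ * R) := by
        refine (neg_le_abs _).trans ?_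
        rw [mul_assoc (2 * ψ x), abs_mul, abs_mul, abs_two]
        exact mul_le_mul_of_nonneg_left h6 (by positivity)
      nlinarith [sq_nonneg (‖ψ x‖ - 2 * (‖gradient ψ x‖ * R))]
    · have h0 : ψ x = 0 := image_eq_zero_of_notMem_tsupport fun h => hx (hsub h)
      simp only [h0, mul_zero, zero_mul, neg_zero]
      positivity
  have h1 : ∫ x, ‖ψ x‖ ^ 2
      ≤ ∫ x, (1 / 2 * ‖ψ x‖ ^ 2 + 2 * R ^ 2 * ‖gradient ψ x‖ ^ 2) := by
    simp only [Real.norm_eq_abs (ψ _), sq_abs] at hbound ⊢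
    rw [key, ← integral_neg]
    refine integral_mono i3.neg ?_ hbound
    have i4 := (i1.const_mul (1 / 2)).add (i2.const_mul (2 * R ^ 2))
    simp only [Real.norm_eq_abs (ψ _), sq_abs] at i4
    exact i4
  rw [integral_add (i1.const_mul _) (i2.const_mul _), integral_const_mul, integral_const_mul] at h1
  linarith

lemma norm_sq_eq_integral {α K : Type*} [MeasurableSpace α] {μ : Measure α}
    [NormedAddCommGroup K] [InnerProductSpace ℝ K] (p : Lp K 2 μ) :
    ‖p‖ ^ 2 = ∫ x, ‖p x‖ ^ 2 ∂μ := by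
  rw [← real_inner_self_eq_norm_sq, L2.inner_def]
  simp only [real_inner_self_eq_norm_sq]

lemma exists_norm_le_mul_norm_grad (hd : 1 ≤ d) (hΩb : Bornology.IsBounded Ω) :
    ∃ C : ℝ, 0 ≤ C ∧ ∀ v : H10 Ω, ‖v‖ ≤ C * ‖grad v‖ := by
  obtain ⟨R, hR⟩ := hΩb.exists_norm_le
  have hfst : ∀ p ∈ (testGraph Ω).topologicalClosure,
      ‖p.fst‖ ^ 2 ≤ 4 * R ^ 2 * ‖p.snd‖ ^ 2 := by
    intro p hp
    refine closure_minimal (s := (testGraph Ω : Set (WithLp 2 (L2 Ω × L2Vec Ω))))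
      (t := {p | ‖p.fst‖ ^ 2 ≤ 4 * R ^ 2 * ‖p.snd‖ ^ 2}) ?_ (isClosed_le ?_ ?_) hp
    · rintro p ⟨ψ, hψ, h1, h2⟩
      have h := integral_sq_le_integral_norm_gradient_sq ⟨0, hd⟩ hR hψ
      have hz : ∀ x, x ∉ Ω → ψ x = 0 := fun x hx =>
        image_eq_zero_of_notMem_tsupport fun h => hx (hψ.2.2 h)
      have hgz : ∀ x, x ∉ Ω → gradient ψ x = 0 := fun x hx => by
        have : fderiv ℝ ψ x = 0 := image_eq_zero_of_notMem_tsupport fun h =>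
          hx (hψ.2.2 (tsupport_fderiv_subset ℝ h))
        simp [gradient, this]
      rw [← setIntegral_eq_integral_of_forall_compl_eq_zero (s := Ω)
          (fun x hx => by simp [hz x hx]),
        ← setIntegral_eq_integral_of_forall_compl_eq_zero (s := Ω)
          (f := fun x => ‖gradient ψ x‖ ^ 2) (fun x hx => by simp [hgz x hx])] at h
      have e1 : ‖p.fst‖ ^ 2 = ∫ x in Ω, ‖ψ x‖ ^ 2 := by
        rw [norm_sq_eq_integral]
        exact integral_congr_ae (h1.mono fun x hx => by simp only [hx])
      have e2 : ‖p.snd‖ ^ 2 = ∫ x in Ω, ‖gradient ψ x‖ ^ 2 := by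
        rw [norm_sq_eq_integral]
        exact integral_congr_ae (h2.mono fun x hx => by simp only [hx])
      rwa [← e1, ← e2] at h
    · exact ((WithLp.fstL 2 ℝ (L2 Ω) (L2Vec Ω)).continuous.norm).pow 2
    · exact (((WithLp.sndL 2 ℝ (L2 Ω) (L2Vec Ω)).continuous.norm).pow 2).const_mul _
  refine ⟨Real.sqrt (4 * R ^ 2 + 1), Real.sqrt_nonneg _, fun v => ?_⟩
  have h1 := hfst v v.2
  have h2 : ‖v‖ ^ 2 = ‖(v : WithLp 2 (L2 Ω × L2Vec Ω)).fst‖ ^ 2 + ‖grad v‖ ^ 2 :=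
    WithLp.prod_norm_sq_eq_of_L2 (v : WithLp 2 (L2 Ω × L2Vec Ω))
  have h3 : grad v = (v : WithLp 2 (L2 Ω × L2Vec Ω)).snd := rfl
  rw [← h3] at h1
  refine abs_le_of_sq_le_sq' ?_ (by positivity) |>.2
  rw [mul_pow, Real.sq_sqrt (by positivity), h2]
  linarith

/-- `H¹₀(Ω)`, with the equivalent norm `‖∇v‖`, is the Hilbert space of the gradients. -/
lemma exists_gradEquiv (hd : 1 ≤ d) (hΩb : Bornology.IsBounded Ω) :
    CompleteSpace (LinearMap.range (grad (Ω := Ω)).toLinearMap) ∧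
    ∃ ι : H10 Ω ≃L[ℝ] LinearMap.range (grad (Ω := Ω)).toLinearMap,
      ∀ v w, inner ℝ (ι v) (ι w) = inner ℝ (grad v) (grad w) := by
  obtain ⟨C, hC, hle⟩ := exists_norm_le_mul_norm_grad (Ω := Ω) hd hΩb
  have hanti : AntilipschitzWith ⟨C, hC⟩ (grad (Ω := Ω)) :=
    ContinuousLinearMap.antilipschitz_of_bound _ hle
  have : CompleteSpace (H10 Ω) :=
    (testGraph Ω).isClosed_topologicalClosure.completeSpace_coe
  have hcl : IsClosed (Set.range (grad (Ω := Ω))) :=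
    hanti.isClosed_range (grad (Ω := Ω)).uniformContinuous
  exact ⟨hcl.completeSpace_coe, (grad (Ω := Ω)).equivRange hanti.injective hcl, fun v w => rfl⟩

end Poincare

/-! ### Dual norms, weak time derivatives and traces in the gradient inner product -/

section Transfer

-- Required to find the norm on `Hneg Ω` under `MemLp`.
set_option maxSynthPendingDepth 5

variable {d : ℕ} {Ω : Set (EuclideanSpace ℝ (Fin d))} {V : Type*} [NormedAddCommGroup V]
  [InnerProductSpace ℝ V] [CompleteSpace V] (ι : H10 Ω ≃L[ℝ] V)

/-- The embedding of `V ≃ H¹₀(Ω)` in `L²(Ω)`. -/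
noncomputable def embL2 : V →L[ℝ] L2 Ω := (toL2 (Ω := Ω)).comp (ι.symm : V →L[ℝ] H10 Ω)

/-- `Φ ↦ R (Φ ∘ ι⁻¹)`, where `R` is the Riesz isomorphism of `V`. -/
noncomputable def rieszComp {W V : Type*} [NormedAddCommGroup W] [NormedSpace ℝ W]
    [NormedAddCommGroup V] [InnerProductSpace ℝ V] [CompleteSpace V] (ι : W ≃L[ℝ] V) :
    StrongDual ℝ W →L[ℝ] V :=
  LinearMap.mkContinuous
    ({ toFun := fun Φ : StrongDual ℝ W =>
        (InnerProductSpace.toDual ℝ V).symm (Φ.comp (ι.symm : V →L[ℝ] W))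
       map_add' := fun Φ Ψ => by rw [ContinuousLinearMap.add_comp, map_add]
       map_smul' := fun c Φ => by
        rw [ContinuousLinearMap.smul_comp, LinearIsometryEquiv.map_smulₛₗ]; rfl } :
      StrongDual ℝ W →ₗ[ℝ] V)
    ‖(ι.symm : V →L[ℝ] W)‖ fun Φ => by
      rw [LinearMap.coe_mk, AddHom.coe_mk, LinearIsometryEquiv.norm_map, mul_comm]
      exact ContinuousLinearMap.opNorm_comp_le _ _

/-- The Riesz representative in `V ≃ H¹₀(Ω)` of a functional on `H¹₀(Ω)`. -/
noncomputable def riesz : Hneg Ω →L[ℝ] V := rieszComp ι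

variable {ι}

omit [CompleteSpace V] in
lemma embL2_apply (v : H10 Ω) : embL2 ι (ι v) = toL2 v := by simp [embL2]

lemma inner_riesz (Φ : Hneg Ω) (x : V) : inner ℝ (riesz ι Φ) x = Φ (ι.symm x) := by
  change inner ℝ ((InnerProductSpace.toDual ℝ V).symm (Φ.comp (ι.symm : V →L[ℝ] H10 Ω))) x = _
  rw [InnerProductSpace.toDual_symm_apply]; rfl

lemma inner_riesz_apply (Φ : Hneg Ω) (v : H10 Ω) : inner ℝ (riesz ι Φ) (ι v) = Φ v := by
  rw [inner_riesz, ContinuousLinearEquiv.symm_apply_apply]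

lemma riesz_toHneg (w : L2 Ω) :
    riesz ι (toHneg w) = ContinuousLinearMap.adjoint (embL2 ι) w := by
  refine ext_inner_right ℝ fun x => ?_
  rw [inner_riesz, ContinuousLinearMap.adjoint_inner_left]
  rfl

lemma riesz_toHneg_toL2 (v : H10 Ω) : riesz ι (toHneg (toL2 v)) = gram (embL2 ι) (ι v) := by
  rw [riesz_toHneg, ← embL2_apply (ι := ι)]; rfl

omit [CompleteSpace V] in
lemma norm_eq_norm_grad (hι : ∀ v w, inner ℝ (ι v) (ι w) = inner ℝ (grad v) (grad w))
    (v : H10 Ω) : ‖ι v‖ = ‖grad v‖ := by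
  rw [norm_eq_sqrt_real_inner, norm_eq_sqrt_real_inner, hι]

/-- The dual norm is the norm of the Riesz representative; when `H¹₀(Ω) = 0` both vanish. -/
lemma dualNorm_eq (hι : ∀ v w, inner ℝ (ι v) (ι w) = inner ℝ (grad v) (grad w)) (Φ : Hneg Ω) :
    dualNorm Φ = ‖riesz ι Φ‖ := by
  have hle : ∀ r ∈ {r : ℝ | ∃ v : H10 Ω, v ≠ 0 ∧ r = Φ v / ‖grad v‖}, r ≤ ‖riesz ι Φ‖ := by
    rintro r ⟨v, hv, rfl⟩
    refine div_le_of_le_mul₀ (norm_nonneg _) (norm_nonneg _) ?_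
    rw [← norm_eq_norm_grad hι, ← inner_riesz_apply (ι := ι)]
    exact real_inner_le_norm _ _
  rw [dualNorm]
  by_cases h0 : riesz ι Φ = 0
  · refine le_antisymm (Real.sSup_le hle (norm_nonneg _)) ?_
    rw [h0, norm_zero]
    refine Real.sSup_nonneg ?_
    rintro r ⟨v, hv, rfl⟩
    rw [← inner_riesz_apply (ι := ι), h0, inner_zero_left, zero_div]
  · refine le_antisymm (Real.sSup_le hle (norm_nonneg _)) (le_csSup ⟨_, hle⟩ ?_)
    refine ⟨ι.symm (riesz ι Φ), by simpa using h0, ?_⟩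
    rw [← norm_eq_norm_grad hι, ← inner_riesz, ContinuousLinearEquiv.apply_symm_apply,
      real_inner_self_eq_norm_sq, sq, mul_div_assoc, div_self (norm_ne_zero_iff.2 h0), mul_one]

variable {T : ℝ}

lemma HasWeakTimeDeriv.unique {φ : SpaceX Ω T} {w w' : L2Hneg Ω T} (h : HasWeakTimeDeriv φ w)
    (h' : HasWeakTimeDeriv φ w') : w = w' := by
  have hi : Integrable w (volume.restrict (Set.Ioo 0 T)) :=
    integrable_of_memLp_two (Lp.memLp w)
  have hi' : Integrable w' (volume.restrict (Set.Ioo 0 T)) :=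
    integrable_of_memLp_two (Lp.memLp w')
  have := ae_eq_zero_of_integral_testFunction_smul (hi.sub hi') fun ψ hψ => by
    simp only [Pi.sub_apply, smul_sub]
    have j : Integrable (fun t => ψ t • w t) (volume.restrict (Set.Ioo 0 T)) :=
      hi.smul_of_top_right (memLp_Ioo_of_continuous hψ.1.continuous _)
    have j' : Integrable (fun t => ψ t • w' t) (volume.restrict (Set.Ioo 0 T)) :=
      hi'.smul_of_top_right (memLp_Ioo_of_continuous hψ.1.continuous _)
    rw [integral_sub j j', sub_eq_zero, ← neg_inj, ← h ψ hψ, ← h' ψ hψ]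
  exact Lp.ext (this.mono fun t ht => sub_eq_zero.1 ht)

lemma hasWeakTimeDeriv_timeDeriv {φ : SpaceX Ω T} (h : φ ∈ SpaceY Ω T) :
    HasWeakTimeDeriv φ (timeDeriv φ) := by
  have h' : ∃ w : L2Hneg Ω T, HasWeakTimeDeriv φ w := h
  rw [timeDeriv, dif_pos h']
  exact h'.choose_spec

lemma timeDeriv_eq {φ : SpaceX Ω T} {w : L2Hneg Ω T} (h : HasWeakTimeDeriv φ w) :
    timeDeriv φ = w :=
  (hasWeakTimeDeriv_timeDeriv ⟨w, h⟩).unique h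

lemma eqOn_Icc_of_ae_eq_Ioo {X : Type*} [TopologicalSpace X] [T2Space X] (hT : 0 < T)
    {f g : ℝ → X} (hf : ContinuousOn f (Set.Icc 0 T)) (hg : ContinuousOn g (Set.Icc 0 T))
    (h : ∀ᵐ t ∂(volume.restrict (Set.Ioo 0 T)), f t = g t) : Set.EqOn f g (Set.Icc 0 T) := by
  refine Measure.eqOn_Icc_of_ae_eq volume hT.ne ?_ hf hg
  rw [Measure.restrict_congr_set (Ioo_ae_eq_Icc (a := (0 : ℝ)) (b := T)).symm]
  exact h

lemma valueAt_spec {φ : SpaceX Ω T} (h : ∃ g : ℝ → L2 Ω, ContinuousOn g (Set.Icc 0 T) ∧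
      ∀ᵐ t ∂(volume.restrict (Set.Ioo 0 T)), g t = toL2 (φ t)) :
    ContinuousOn (valueAt φ) (Set.Icc 0 T) ∧
      ∀ᵐ t ∂(volume.restrict (Set.Ioo 0 T)), valueAt φ t = toL2 (φ t) := by
  rw [valueAt, dif_pos h]
  exact h.choose_spec

lemma valueAt_eq (hT : 0 < T) {φ : SpaceX Ω T} {g : ℝ → L2 Ω} (hg : ContinuousOn g (Set.Icc 0 T))
    (h : ∀ᵐ t ∂(volume.restrict (Set.Ioo 0 T)), g t = toL2 (φ t)) :
    Set.EqOn (valueAt φ) g (Set.Icc 0 T) := by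
  obtain ⟨h1, h2⟩ := valueAt_spec ⟨g, hg, h⟩
  exact eqOn_Icc_of_ae_eq_Ioo hT h1 hg (by filter_upwards [h, h2] with t a b; rw [a, b])

omit [CompleteSpace V] in
lemma memLp_equiv (ι : H10 Ω ≃L[ℝ] V) (φ : SpaceX Ω T) :
    MemLp (fun t => ι (φ t)) 2 (volume.restrict (Set.Ioo 0 T)) :=
  (ι : H10 Ω →L[ℝ] V).comp_memLp' (Lp.memLp φ)

lemma memLp_riesz (ι : H10 Ω ≃L[ℝ] V) (w : L2Hneg Ω T) :
    MemLp (fun t => riesz ι (w t)) 2 (volume.restrict (Set.Ioo 0 T)) :=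
  (riesz ι).comp_memLp' (Lp.memLp w)

lemma continuous_toHneg : Continuous fun w : L2 Ω => toHneg w := by unfold toHneg; fun_prop

/-- A function in `Y` is absolutely continuous with values in `H⁻¹(Ω) ≃ V`. -/
lemma HasWeakTimeDeriv.exists_ae_eq_const_add_prim (ι : H10 Ω ≃L[ℝ] V) (hT : 0 < T)
    {φ : SpaceX Ω T} {w : L2Hneg Ω T} (h : HasWeakTimeDeriv φ w) :
    ∃ c : V, ∀ᵐ t ∂(volume.restrict (Set.Ioo 0 T)), gram (embL2 ι) (ι (φ t))
      = c + prim (volume.restrict (Set.Ioo 0 T)) (fun t => riesz ι (w t)) t := by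
  have hi : Integrable (fun t => toHneg (toL2 (φ t))) (volume.restrict (Set.Ioo 0 T)) := by
    have h1 := integrable_of_memLp_two ((toL2 (Ω := Ω)).comp_memLp' (Lp.memLp φ))
    refine (h1.norm.mul_const ‖toL2 (Ω := Ω)‖).mono'
      (continuous_toHneg.comp_aestronglyMeasurable h1.1) (Filter.Eventually.of_forall fun t => ?_)
    refine (ContinuousLinearMap.opNorm_comp_le _ _).trans ?_
    rw [innerSL_apply_norm]; rfl
  have hw : Integrable w (volume.restrict (Set.Ioo 0 T)) :=
    integrable_of_memLp_two (Lp.memLp w)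
  refine HeatEuler.exists_ae_eq_const_add_prim hT
    (integrable_of_memLp_two ((gram (embL2 ι)).comp_memLp' (memLp_equiv ι φ)))
    (integrable_of_memLp_two (memLp_riesz ι w)) fun ψ hψ => ?_
  have j : Integrable (fun t => ψ t • w t) (volume.restrict (Set.Ioo 0 T)) :=
      hw.smul_of_top_right (memLp_Ioo_of_continuous hψ.1.continuous _)
  have j' : Integrable (fun t => deriv ψ t • toHneg (toL2 (φ t)))
      (volume.restrict (Set.Ioo 0 T)) :=
      hi.smul_of_top_right (memLp_Ioo_of_continuous (hψ.1.continuous_deriv (by simp)) _)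
  have := congrArg (riesz ι) (h ψ hψ)
  rw [map_neg, ← ContinuousLinearMap.integral_comp_comm _ j,
    ← ContinuousLinearMap.integral_comp_comm _ j'] at this
  simpa only [map_smul, riesz_toHneg_toL2] using this

/-- The continuous representative exists. -/
lemma valueAt_spec_of_mem (ι : H10 Ω ≃L[ℝ] V) (hT : 0 < T) {φ : SpaceX Ω T}
    (h : φ ∈ SpaceY Ω T) :
    ContinuousOn (valueAt φ) (Set.Icc 0 T) ∧
      ∀ᵐ t ∂(volume.restrict (Set.Ioo 0 T)), valueAt φ t = toL2 (φ t) := by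
  obtain ⟨w, hw⟩ := h
  obtain ⟨c, hc⟩ := hw.exists_ae_eq_const_add_prim ι hT
  obtain ⟨y, hy, hy'⟩ := exists_continuousOn_representative (J := embL2 ι) hT (memLp_equiv ι φ)
    (memLp_riesz ι w) fun ψ hψ h0 hT0 => by
      have h1 := integral_const_add_prim_deriv hT.le (innerB V)
        (integrable_of_memLp_two (memLp_riesz ι w)) c hψ
      simp only [h0, hT0, map_zero, sub_zero, innerB_apply] at h1
      refine Eq.trans (integral_congr_ae ?_) h1
      filter_upwards [hc] with t ht
      rw [ht]
  exact valueAt_spec ⟨y, hy, by simpa only [embL2_apply] using hy'⟩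

/-- Integration by parts of `u ∈ Y` against a `C¹` function, with boundary terms. -/
lemma integral_inner_add_eq_of_mem (ι : H10 Ω ≃L[ℝ] V) (hT : 0 < T) {u : SpaceX Ω T}
    (h : u ∈ SpaceY Ω T) {φ : ℝ → V} (hφ : ContDiff ℝ 1 φ) :
    ∫ t in Set.Ioo 0 T, (inner ℝ (embL2 ι (ι (u t))) (embL2 ι (deriv φ t))
        + inner ℝ (riesz ι (timeDeriv u t)) (φ t))
      = inner ℝ (valueAt u T) (embL2 ι (φ T)) - inner ℝ (valueAt u 0) (embL2 ι (φ 0)) := by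
  obtain ⟨c, hc⟩ := (hasWeakTimeDeriv_timeDeriv h).exists_ae_eq_const_add_prim ι hT
  obtain ⟨hcont, hae⟩ := valueAt_spec_of_mem ι hT h
  have hri := integrable_of_memLp_two (memLp_riesz ι (timeDeriv u))
  have heq := eqOn_Icc_of_ae_eq_Ioo hT
    ((ContinuousLinearMap.adjoint (embL2 ι)).continuous.comp_continuousOn hcont)
    ((continuous_const.add (continuous_prim hri)).continuousOn (f := fun t =>
      c + prim (volume.restrict (Set.Ioo 0 T)) (fun t => riesz ι (timeDeriv u t)) t))
    (by
      filter_upwards [hc, hae] with t h1 h2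
      rw [← h1, Function.comp_apply, h2, ← embL2_apply (ι := ι)]; rfl)
  have h0 := heq (Set.left_mem_Icc.2 hT.le)
  have hT' := heq (Set.right_mem_Icc.2 hT.le)
  simp only [Function.comp_apply] at h0 hT'
  have p0 : prim (volume.restrict (Set.Ioo 0 T)) (fun t => riesz ι (timeDeriv u t)) 0 = 0 := by
    rw [prim, Measure.restrict_restrict measurableSet_Iic]
    have : Set.Iic (0 : ℝ) ∩ Set.Ioo 0 T = ∅ := by
      ext x; simp only [Set.mem_inter_iff, Set.mem_Iic, Set.mem_Ioo, Set.mem_empty_iff_false,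
        iff_false]
      rintro ⟨a, b, -⟩; linarith
    rw [this]; simp
  have pT : prim (volume.restrict (Set.Ioo 0 T)) (fun t => riesz ι (timeDeriv u t)) T
      = ∫ t in Set.Ioo 0 T, riesz ι (timeDeriv u t) := by
    rw [prim, Measure.restrict_restrict measurableSet_Iic]
    congr 2
    exact Set.inter_eq_right.2 fun x hx => hx.2.le
  have h1 := integral_const_add_prim_deriv hT.le (innerB V) hri c hφ
  rw [p0, add_zero] at h0
  rw [pT] at hT'
  simp only [innerB_apply] at h1
  rw [← hT', ← h0, ContinuousLinearMap.adjoint_inner_left,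
    ContinuousLinearMap.adjoint_inner_left] at h1
  rw [← h1]
  refine integral_congr_ae ?_
  filter_upwards [hc] with t ht
  rw [h0, ← ht, inner_gram_left]

/-! ### Smooth functions as elements of `Y` -/

/-- The element of `X` represented by a `C¹` function with values in `V`. -/
noncomputable def smoothX (ι : H10 Ω ≃L[ℝ] V) (T : ℝ) {φ : ℝ → V} (hφ : ContDiff ℝ 1 φ) :
    SpaceX Ω T :=
  (memLp_Ioo_of_continuous (ι.symm.continuous.comp hφ.continuous) 2).toLp
    (fun t => ι.symm (φ t))

omit [CompleteSpace V] in
lemma smoothX_ae (ι : H10 Ω ≃L[ℝ] V) (T : ℝ) {φ : ℝ → V} (hφ : ContDiff ℝ 1 φ) :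
    ∀ᵐ t ∂(volume.restrict (Set.Ioo 0 T)), smoothX ι T hφ t = ι.symm (φ t) :=
  MemLp.coeFn_toLp _

omit [CompleteSpace V] in
lemma exists_hasWeakTimeDeriv_smoothX (ι : H10 Ω ≃L[ℝ] V) (hT : 0 < T) {φ : ℝ → V}
    (hφ : ContDiff ℝ 1 φ) :
    ∃ w : L2Hneg Ω T, HasWeakTimeDeriv (smoothX ι T hφ) w ∧
      ∀ᵐ t ∂(volume.restrict (Set.Ioo 0 T)), w t = toHneg (embL2 ι (deriv φ t)) := by
  have hc : Continuous fun t => toHneg (embL2 ι (deriv φ t)) :=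
    continuous_toHneg.comp ((embL2 ι).continuous.comp (hφ.continuous_deriv le_rfl))
  have hm := memLp_Ioo_of_continuous (T := T) hc 2
  refine ⟨hm.toLp _, fun ψ hψ => ?_, hm.coeFn_toLp⟩
  let K : V →L[ℝ] Hneg Ω := LinearMap.mkContinuous
    { toFun := fun x => toHneg (embL2 ι x)
      map_add' := fun x y => by simp [toHneg]
      map_smul' := fun c x => by simp [toHneg] }
    (‖toL2 (Ω := Ω)‖ * ‖embL2 ι‖) fun x => by
      refine (ContinuousLinearMap.opNorm_comp_le _ _).trans ?_
      rw [innerSL_apply_norm, mul_comm, mul_assoc]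
      exact mul_le_mul_of_nonneg_left ((embL2 ι).le_opNorm x) (norm_nonneg _)
  have hK : ContDiff ℝ 1 fun t => K (φ t) := K.contDiff.comp hφ
  have hψ1 : ContDiff ℝ 1 ψ := hψ.1.of_le (by simp)
  have hd : ∀ t, deriv (fun t => ψ t • K (φ t)) t
      = deriv ψ t • toHneg (embL2 ι (φ t)) + ψ t • toHneg (embL2 ι (deriv φ t)) := fun t => by
    have h1 := (hψ1.differentiable one_ne_zero t).hasDerivAt
    have h2 : HasDerivAt (fun t => K (φ t)) (K (deriv φ t)) t :=
      K.hasFDerivAt.comp_hasDerivAt t (hφ.differentiable one_ne_zero t).hasDerivAt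
    have h3 : HasDerivAt (fun t => ψ t • K (φ t)) (ψ t • K (deriv φ t) + deriv ψ t • K (φ t)) t :=
      h1.smul h2
    rw [h3.deriv, add_comm]; rfl
  have hzero := integral_Ioo_deriv hT.le (hψ1.smul hK)
  have hzero' : ∫ t in Set.Ioo 0 T, deriv (fun t => ψ t • K (φ t)) t = 0 := by
    refine hzero.trans ?_
    simp [hψ.map_boundary.1, hψ.map_boundary.2]
  simp only [hd] at hzero'
  have hc2 : Continuous fun t => toHneg (embL2 ι (φ t)) :=
    continuous_toHneg.comp ((embL2 ι).continuous.comp hφ.continuous)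
  have i1 : Integrable (fun t => deriv ψ t • toHneg (embL2 ι (φ t)))
      (volume.restrict (Set.Ioo 0 T)) :=
    integrable_Ioo_of_continuous ((hψ1.continuous_deriv le_rfl).smul hc2)
  have i2 : Integrable (fun t => ψ t • toHneg (embL2 ι (deriv φ t)))
      (volume.restrict (Set.Ioo 0 T)) :=
    integrable_Ioo_of_continuous (hψ1.continuous.smul hc)
  rw [integral_add i1 i2] at hzero'
  have e1 : ∫ t in Set.Ioo 0 T, deriv ψ t • toHneg (toL2 (smoothX ι T hφ t))
      = ∫ t in Set.Ioo 0 T, deriv ψ t • toHneg (embL2 ι (φ t)) :=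
    integral_congr_ae ((smoothX_ae ι T hφ).mono fun t ht => by simp only [ht]; rfl)
  have e2 : ∫ t in Set.Ioo 0 T, ψ t • hm.toLp _ t
      = ∫ t in Set.Ioo 0 T, ψ t • toHneg (embL2 ι (deriv φ t)) :=
    integral_congr_ae (hm.coeFn_toLp.mono fun t ht => by simp only [ht])
  rw [e1, e2]
  exact eq_neg_of_add_eq_zero_left hzero'

omit [CompleteSpace V] in
lemma smoothX_mem (ι : H10 Ω ≃L[ℝ] V) (hT : 0 < T) {φ : ℝ → V} (hφ : ContDiff ℝ 1 φ) :
    smoothX ι T hφ ∈ SpaceY Ω T :=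
  (exists_hasWeakTimeDeriv_smoothX ι hT hφ).imp fun _ h => h.1

lemma normYs_smoothX (hι : ∀ v w, inner ℝ (ι v) (ι w) = inner ℝ (grad v) (grad w)) (hT : 0 < T)
    {φ : ℝ → V} (hφ : ContDiff ℝ 1 φ) :
    normYs (smoothX ι T hφ)
      = Real.sqrt ((∫ t in Set.Ioo 0 T, (‖gram (embL2 ι) (deriv φ t)‖ ^ 2 + ‖φ t‖ ^ 2))
        + ‖embL2 ι (φ 0)‖ ^ 2 + ‖embL2 ι (φ T)‖ ^ 2) := by
  obtain ⟨w, hw, hae⟩ := exists_hasWeakTimeDeriv_smoothX ι hT hφ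
  have hv := valueAt_eq hT (φ := smoothX ι T hφ) (g := fun t => embL2 ι (φ t))
    ((embL2 ι).continuous.comp hφ.continuous).continuousOn
    ((smoothX_ae ι T hφ).mono fun t ht => by rw [ht]; rfl)
  rw [normYs, hv (Set.left_mem_Icc.2 hT.le), hv (Set.right_mem_Icc.2 hT.le), timeDeriv_eq hw]
  congr 3
  refine integral_congr_ae ?_
  filter_upwards [hae, smoothX_ae ι T hφ] with t h1 h2
  rw [h1, h2, dualNorm_eq hι, riesz_toHneg, ← norm_eq_norm_grad hι,
    ContinuousLinearEquiv.apply_symm_apply]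
  rfl

/-- The two isometries behind the estimates: the time-symmetric norm is the norm of the residual
of the forward or backward heat equation, together with the trace at one end. -/
lemma normYs_smoothX_eq_heatOp (hι : ∀ v w, inner ℝ (ι v) (ι w) = inner ℝ (grad v) (grad w))
    (hT : 0 < T) {φ : ℝ → V} (hφ : ContDiff ℝ 1 φ) :
    normYs (smoothX ι T hφ) = Real.sqrt ((∫ t in Set.Ioo 0 T, ‖heatOp (embL2 ι) 1 φ t‖ ^ 2)
        + 2 * ‖embL2 ι (φ 0)‖ ^ 2) ∧
    normYs (smoothX ι T hφ) = Real.sqrt ((∫ t in Set.Ioo 0 T, ‖heatOp (embL2 ι) (-1) φ t‖ ^ 2)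
        + 2 * ‖embL2 ι (φ T)‖ ^ 2) := by
  rw [normYs_smoothX hι hT hφ, integral_norm_heatOp_sq hT.le (by norm_num) hφ,
    integral_norm_heatOp_sq hT.le (by norm_num) hφ]
  constructor <;> congr 1 <;> ring

end Transfer

/-! ### The implicit Euler reconstructions -/

section Euler

-- Required to find the norm on `Hneg Ω` under `MemLp`.
set_option maxSynthPendingDepth 5

variable {d : ℕ} {Ω : Set (EuclideanSpace ℝ (Fin d))} {T : ℝ} {N : ℕ} {t : ℕ → ℝ}

lemma IsTimePartition.mono (ht : IsTimePartition T N t) {m n : ℕ} (hmn : m ≤ n) (hn : n ≤ N) :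
    t m ≤ t n := by
  induction n, hmn using Nat.le_induction with
  | base => exact le_rfl
  | succ k hk ih => exact (ih (by omega)).trans (ht.lt_succ k (by omega)).le

lemma IsTimePartition.eq_of_mem_Ioc (ht : IsTimePartition T N t) {m n : ℕ} (hm : m < N)
    (hn : n < N) {s : ℝ} (h : s ∈ Set.Ioc (t m) (t (m + 1))) (h' : s ∈ Set.Ioc (t n) (t (n + 1))) :
    m = n := by
  rcases lt_trichotomy m n with hlt | heq | hgt
  · exact absurd (h'.1.trans_le h.2) (not_lt.2 (ht.mono hlt hn.le))
  · exact heq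
  · exact absurd (h.1.trans_le h'.2) (not_lt.2 (ht.mono hgt hm.le))

/-- A sum over the time steps of functions supported in the respective time steps. -/
lemma IsTimePartition.sum_indicator (ht : IsTimePartition T N t) {E : Type*} [AddCommMonoid E]
    (S : ℕ → Set ℝ) (hS : ∀ n, S n ⊆ Set.Ioc (t n) (t (n + 1))) (F : ℕ → ℝ → E) {k : ℕ}
    (hk : k < N) {s : ℝ} (hs : s ∈ S k) :
    ∑ n ∈ Finset.range N, Set.indicator (S n) (F n) s = F k s := by
  rw [Finset.sum_eq_single_of_mem k (Finset.mem_range.2 hk), Set.indicator_of_mem hs]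
  intro n hn hne
  refine Set.indicator_of_notMem (fun h => hne ?_) _
  exact ht.eq_of_mem_Ioc (Finset.mem_range.1 hn) hk (hS n h) (hS k hs)

lemma IsTimePartition.indicator_start (ht : IsTimePartition T N t) {E : Type*} [AddCommMonoid E]
    {k : ℕ} (hk : k < N) {s : ℝ} (hs : s ∈ Set.Ioc (t k) (t (k + 1))) (F : ℝ → E) :
    Set.indicator {t 0} F s = 0 := by
  refine Set.indicator_of_notMem (fun h => ?_) _
  rw [Set.mem_singleton_iff] at h
  exact absurd hs.1 (not_lt.2 (h ▸ ht.mono (Nat.zero_le k) hk.le))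

variable {un : ℕ → H10 Ω} {fn : ℕ → Hneg Ω}

lemma constRec_apply (ht : IsTimePartition T N t) {k : ℕ} (hk : k < N) {s : ℝ}
    (hs : s ∈ Set.Ioc (t k) (t (k + 1))) : constRec N t un s = un (k + 1) := by
  rw [constRec, ht.indicator_start hk hs, zero_add]
  exact ht.sum_indicator (fun n => Set.Ioc (t n) (t (n + 1))) (fun _ => subset_rfl)
    (fun n _ => un (n + 1)) hk hs

lemma affineRec_apply (ht : IsTimePartition T N t) {k : ℕ} (hk : k < N) {s : ℝ}
    (hs : s ∈ Set.Ioc (t k) (t (k + 1))) : affineRec N t un s =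
      ((s - t k) / (t (k + 1) - t k)) • un (k + 1)
        + ((t (k + 1) - s) / (t (k + 1) - t k)) • un k := by
  rw [affineRec, ht.indicator_start hk hs, zero_add]
  exact ht.sum_indicator (fun n => Set.Ioc (t n) (t (n + 1))) (fun _ => subset_rfl)
    (fun n r => ((r - t n) / (t (n + 1) - t n)) • un (n + 1)
        + ((t (n + 1) - r) / (t (n + 1) - t n)) • un n) hk hs

lemma sourceRec_apply (ht : IsTimePartition T N t) {k : ℕ} (hk : k < N) {s : ℝ}
    (hs : s ∈ Set.Ioo (t k) (t (k + 1))) : sourceRec N t fn s = fn (k + 1) :=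
  ht.sum_indicator (fun n => Set.Ioo (t n) (t (n + 1))) (fun _ => Set.Ioo_subset_Ioc_self)
    (fun n _ => fn (n + 1)) hk hs

lemma averageRec_final (ht : IsTimePartition T N t) : averageRec N t un T = un N := by
  obtain ⟨k, rfl⟩ : ∃ k, N = k + 1 := ⟨N - 1, by have := ht.one_le; omega⟩
  have hlt := ht.lt_succ k (Nat.lt_succ_self k)
  have hs : T ∈ Set.Ioc (t k) (t (k + 1)) := by rw [← ht.finish]; exact ⟨hlt, le_rfl⟩
  rw [averageRec, constRec_apply ht (Nat.lt_succ_self k) hs,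
    affineRec_apply ht (Nat.lt_succ_self k) hs, ← ht.finish, sub_self, zero_div, zero_smul,
    add_zero, div_self (sub_pos.2 hlt).ne', one_smul, ← two_smul ℝ, smul_smul]
  norm_num

lemma memLp_constRec : MemLp (constRec N t un) 2 (volume.restrict (Set.Ioo 0 T)) := by
  unfold constRec
  refine MemLp.add ((memLp_const _).indicator (measurableSet_singleton _)) ?_
  exact memLp_finsetSum _ fun n _ => (memLp_const _).indicator measurableSet_Ioc

lemma memLp_affineRec : MemLp (affineRec N t un) 2 (volume.restrict (Set.Ioo 0 T)) := by
  unfold affineRec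
  refine MemLp.add ((memLp_const _).indicator (measurableSet_singleton _)) ?_
  exact memLp_finsetSum _ fun n _ => MemLp.indicator measurableSet_Ioc
    (memLp_Ioo_of_continuous (by fun_prop) 2)

lemma memLp_sourceRec : MemLp (sourceRec N t fn) 2 (volume.restrict (Set.Ioo 0 T)) := by
  unfold sourceRec
  exact memLp_finsetSum _ fun n _ => (memLp_const _).indicator measurableSet_Ioo

lemma memLp_averageRec : MemLp (averageRec N t un) 2 (volume.restrict (Set.Ioo 0 T)) :=
  (memLp_constRec.add memLp_affineRec).const_smul (1 / 2 : ℝ)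

/-- Telescoping over the time steps. -/
lemma IsTimePartition.integral_eq_sub (ht : IsTimePartition T N t) {F : ℝ → ℝ}
    (hF : Integrable F (volume.restrict (Set.Ioo 0 T))) (b : ℕ → ℝ)
    (h : ∀ k < N, ∫ s in Set.Ioo (t k) (t (k + 1)), F s = b (k + 1) - b k) :
    ∫ s in Set.Ioo 0 T, F s = b N - b 0 := by
  have h0T : (0 : ℝ) ≤ T := by rw [← ht.start, ← ht.finish]; exact ht.mono (Nat.zero_le N) le_rfl
  have hi : ∀ k < N, IntervalIntegrable F volume (t k) (t (k + 1)) := fun k hk => by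
    rw [intervalIntegrable_iff_integrableOn_Ioo_of_le (ht.lt_succ k hk).le]
    refine IntegrableOn.mono_set hF (Set.Ioo_subset_Ioo ?_ ?_)
    · rw [← ht.start]; exact ht.mono (Nat.zero_le k) hk.le
    · rw [← ht.finish]; exact ht.mono hk le_rfl
  rw [← integral_Ioc_eq_integral_Ioo, ← intervalIntegral.integral_of_le h0T]
  have hs := intervalIntegral.sum_integral_adjacent_intervals hi
  rw [ht.start, ht.finish] at hs
  rw [← hs, ← Finset.sum_range_sub]
  refine Finset.sum_congr rfl fun k hk => ?_
  have hk' := Finset.mem_range.1 hk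
  rw [intervalIntegral.integral_of_le (ht.lt_succ k hk').le, integral_Ioc_eq_integral_Ioo, h k hk']

variable {V : Type*} [NormedAddCommGroup V] [InnerProductSpace ℝ V] [CompleteSpace V]

/-- The residual identity of the implicit Euler scheme, tested with a `C¹` function: the affine
reconstruction appears in the time derivative and the constant one in the gradient. -/
lemma integral_euler {ι : H10 Ω ≃L[ℝ] V}
    (hι : ∀ v w, inner ℝ (ι v) (ι w) = inner ℝ (grad v) (grad w)) (ht : IsTimePartition T N t)
    (hun : IsImplicitEuler N t fn un) {φ : ℝ → V} (hφ : ContDiff ℝ 1 φ) :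
    ∫ s in Set.Ioo 0 T, (inner ℝ (ι (constRec N t un s)) (φ s)
        - inner ℝ (embL2 ι (ι (affineRec N t un s))) (embL2 ι (deriv φ s))
        - inner ℝ (riesz ι (sourceRec N t fn s)) (φ s))
      = inner ℝ (toL2 (un 0)) (embL2 ι (φ 0)) - inner ℝ (toL2 (un N)) (embL2 ι (φ T)) := by
  have hφc := hφ.continuous
  have hφd := hφ.continuous_deriv le_rfl
  have mφ : MemLp φ 2 (volume.restrict (Set.Ioo 0 T)) := memLp_Ioo_of_continuous hφc 2
  have mφ' : MemLp (fun s => embL2 ι (deriv φ s)) 2 (volume.restrict (Set.Ioo 0 T)) :=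
    memLp_Ioo_of_continuous (by fun_prop) 2
  have i1 : Integrable (fun s => inner ℝ (ι (constRec N t un s)) (φ s))
      (volume.restrict (Set.Ioo 0 T)) :=
    integrable_inner ((ι : H10 Ω →L[ℝ] V).comp_memLp' memLp_constRec) mφ
  have i2 : Integrable (fun s => inner ℝ (embL2 ι (ι (affineRec N t un s)))
      (embL2 ι (deriv φ s))) (volume.restrict (Set.Ioo 0 T)) :=
    integrable_inner (((embL2 ι).comp (ι : H10 Ω →L[ℝ] V)).comp_memLp' memLp_affineRec) mφ'
  have i3 : Integrable (fun s => inner ℝ (riesz ι (sourceRec N t fn s)) (φ s))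
      (volume.restrict (Set.Ioo 0 T)) :=
    integrable_inner ((riesz ι).comp_memLp' memLp_sourceRec) mφ
  have key := ht.integral_eq_sub ((i1.sub i2).sub i3)
    (fun n => -inner ℝ (toL2 (un n)) (embL2 ι (φ (t n)))) fun k hk => by
      have hlt := ht.lt_succ k hk
      have hτ : t (k + 1) - t k ≠ 0 := (sub_pos.2 hlt).ne'
      set U : ℝ → L2 Ω := fun s => ((s - t k) / (t (k + 1) - t k)) • toL2 (un (k + 1))
        + ((t (k + 1) - s) / (t (k + 1) - t k)) • toL2 (un k) with hU
      set D : L2 Ω := (t (k + 1) - t k)⁻¹ • (toL2 (un (k + 1)) - toL2 (un k)) with hD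
      have hUd : ∀ s, HasDerivAt U D s := fun s => by
        have h1 : HasDerivAt (fun s => (s - t k) / (t (k + 1) - t k)) (1 / (t (k + 1) - t k)) s :=
          ((hasDerivAt_id s).sub_const _).div_const _
        have h2 : HasDerivAt (fun s => (t (k + 1) - s) / (t (k + 1) - t k))
            (-1 / (t (k + 1) - t k)) s := ((hasDerivAt_id s).const_sub _).div_const _
        have hD' : D = (1 / (t (k + 1) - t k)) • toL2 (un (k + 1))
            + (-1 / (t (k + 1) - t k)) • toL2 (un k) := by
          rw [hD, smul_sub, neg_div, neg_smul, one_div, sub_eq_add_neg]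
        rw [hD']
        exact (h1.smul_const (toL2 (un (k + 1)))).add (h2.smul_const (toL2 (un k)))
      have hd : ∀ s, HasDerivAt (fun s => -inner ℝ (U s) (embL2 ι (φ s)))
          (-(inner ℝ (U s) (embL2 ι (deriv φ s)) + inner ℝ D (embL2 ι (φ s)))) s := fun s =>
        ((hUd s).inner ℝ ((embL2 ι).hasFDerivAt.comp_hasDerivAt s
          (hφ.differentiable one_ne_zero s).hasDerivAt)).neg
      have hUc : Continuous U := by rw [hU]; fun_prop
      have hftc := intervalIntegral.integral_eq_sub_of_hasDerivAt (a := t k) (b := t (k + 1))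
        (fun s _ => hd s) ((by fun_prop : Continuous fun s =>
          -(inner ℝ (U s) (embL2 ι (deriv φ s))
            + inner ℝ D (embL2 ι (φ s)))).intervalIntegrable _ _)
      have e1 : U (t (k + 1)) = toL2 (un (k + 1)) := by
        simp [hU, div_self hτ]
      have e2 : U (t k) = toL2 (un k) := by
        simp [hU, div_self hτ]
      rw [e1, e2] at hftc
      rw [← hftc, intervalIntegral.integral_of_le hlt.le, integral_Ioc_eq_integral_Ioo]
      refine setIntegral_congr_fun measurableSet_Ioo fun s hs => ?_
      have hs' := Set.Ioo_subset_Ioc_self hs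
      have hE := hun k hk (ι.symm (φ s))
      rw [← hD, ← inner_riesz, ← hι, ι.apply_symm_apply] at hE
      have hE' : toL2 (ι.symm (φ s)) = embL2 ι (φ s) := rfl
      rw [hE'] at hE
      simp only [Pi.sub_apply]
      rw [constRec_apply ht hk hs', sourceRec_apply ht hk hs, ← hE, embL2_apply,
        affineRec_apply ht hk hs', map_add, map_smul, map_smul]
      ring
  simp only [Pi.sub_apply, ht.start, ht.finish] at key
  rw [key]
  ring

/-- The error identity: tested with the backward heat operator, the error is the data oscillation
plus one half of the jump tested with the forward heat operator. -/
lemma integral_error_identity {ι : H10 Ω ≃L[ℝ] V}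
    (hι : ∀ v w, inner ℝ (ι v) (ι w) = inner ℝ (grad v) (grad w)) (hT : 0 < T)
    {f : L2Hneg Ω T} {u : SpaceX Ω T} (hu : IsWeakSolution f (toL2 (un 0)) u)
    (ht : IsTimePartition T N t) (hun : IsImplicitEuler N t fn un) {φ : ℝ → V}
    (hφ : ContDiff ℝ 1 φ) :
    (∫ s in Set.Ioo 0 T, inner ℝ (ι (u s - averageRec N t un s)) (heatOp (embL2 ι) (-1) φ s))
        + inner ℝ (valueAt u T - toL2 (averageRec N t un T)) (embL2 ι (φ T))
      = (∫ s in Set.Ioo 0 T, inner ℝ (riesz ι (f s - sourceRec N t fn s)) (φ s))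
        + 1 / 2 * ∫ s in Set.Ioo 0 T,
          inner ℝ (ι (constRec N t un s - affineRec N t un s)) (heatOp (embL2 ι) 1 φ s) := by
  have hφc := hφ.continuous
  have hφd := hφ.continuous_deriv le_rfl
  have mφ : MemLp φ 2 (volume.restrict (Set.Ioo 0 T)) := memLp_Ioo_of_continuous hφc 2
  have mφ' : MemLp (fun s => embL2 ι (deriv φ s)) 2 (volume.restrict (Set.Ioo 0 T)) :=
    memLp_Ioo_of_continuous (by fun_prop) 2
  have i0 : Integrable (fun s => inner ℝ (ι (u s - averageRec N t un s))
      (heatOp (embL2 ι) (-1) φ s)) (volume.restrict (Set.Ioo 0 T)) :=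
    integrable_inner ((ι : H10 Ω →L[ℝ] V).comp_memLp' ((Lp.memLp u).sub memLp_averageRec))
      (memLp_heatOp _ hφ T)
  have i1 : Integrable (fun s => inner ℝ (riesz ι (f s - sourceRec N t fn s)) (φ s))
      (volume.restrict (Set.Ioo 0 T)) :=
    integrable_inner ((riesz ι).comp_memLp' ((Lp.memLp f).sub memLp_sourceRec)) mφ
  have i2 : Integrable (fun s => 1 / 2 * inner ℝ (ι (constRec N t un s - affineRec N t un s))
      (heatOp (embL2 ι) 1 φ s)) (volume.restrict (Set.Ioo 0 T)) :=
    (integrable_inner ((ι : H10 Ω →L[ℝ] V).comp_memLp' (memLp_constRec.sub memLp_affineRec))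
      (memLp_heatOp _ hφ T)).const_mul _
  have i3 : Integrable (fun s => inner ℝ (embL2 ι (ι (u s))) (embL2 ι (deriv φ s))
      + inner ℝ (riesz ι (timeDeriv u s)) (φ s)) (volume.restrict (Set.Ioo 0 T)) :=
    (integrable_inner (((embL2 ι).comp (ι : H10 Ω →L[ℝ] V)).comp_memLp' (Lp.memLp u)) mφ').add
      (integrable_inner (memLp_riesz ι _) mφ)
  have i4 : Integrable (fun s => inner ℝ (ι (constRec N t un s)) (φ s)
        - inner ℝ (embL2 ι (ι (affineRec N t un s))) (embL2 ι (deriv φ s))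
        - inner ℝ (riesz ι (sourceRec N t fn s)) (φ s)) (volume.restrict (Set.Ioo 0 T)) :=
    ((integrable_inner ((ι : H10 Ω →L[ℝ] V).comp_memLp' memLp_constRec) mφ).sub
      (integrable_inner (((embL2 ι).comp (ι : H10 Ω →L[ℝ] V)).comp_memLp' memLp_affineRec)
        mφ')).sub (integrable_inner ((riesz ι).comp_memLp' memLp_sourceRec) mφ)
  have hA := integral_inner_add_eq_of_mem ι hT hu.mem_Y hφ
  have hB := integral_euler hι ht hun hφ
  rw [hu.initial] at hA
  have hmain : (∫ s in Set.Ioo 0 T, (inner ℝ (ι (u s - averageRec N t un s))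
        (heatOp (embL2 ι) (-1) φ s) - inner ℝ (riesz ι (f s - sourceRec N t fn s)) (φ s)
        - 1 / 2 * inner ℝ (ι (constRec N t un s - affineRec N t un s)) (heatOp (embL2 ι) 1 φ s)))
      = ∫ s in Set.Ioo 0 T, -((inner ℝ (embL2 ι (ι (u s))) (embL2 ι (deriv φ s))
          + inner ℝ (riesz ι (timeDeriv u s)) (φ s))
        + (inner ℝ (ι (constRec N t un s)) (φ s)
        - inner ℝ (embL2 ι (ι (affineRec N t un s))) (embL2 ι (deriv φ s))
        - inner ℝ (riesz ι (sourceRec N t fn s)) (φ s))) := by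
    refine integral_congr_ae ?_
    filter_upwards [hu.equation] with s hs
    have hs' := hs (ι.symm (φ s))
    rw [← hι, ι.apply_symm_apply, ← inner_riesz, ← inner_riesz] at hs'
    simp only [inner_heatOp, averageRec, map_sub, map_smul, map_add, inner_sub_left,
      inner_add_left, real_inner_smul_left]
    linarith
  have i5 : Integrable (fun s => inner ℝ (ι (u s - averageRec N t un s))
        (heatOp (embL2 ι) (-1) φ s) - inner ℝ (riesz ι (f s - sourceRec N t fn s)) (φ s))
      (volume.restrict (Set.Ioo 0 T)) := i0.sub i1
  rw [integral_sub i5 i2, integral_sub i0 i1, integral_neg, integral_add i3 i4, hB, hA,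
    integral_const_mul] at hmain
  rw [averageRec_final ht, inner_sub_left]
  linarith

end Euler

/-! ### The data oscillation and the two estimates -/

section Estimates

-- Required to find the norm on `Hneg Ω` under `MemLp`.
set_option maxSynthPendingDepth 5

variable {d : ℕ} {Ω : Set (EuclideanSpace ℝ (Fin d))} {T : ℝ} {V : Type*} [NormedAddCommGroup V]
  [InnerProductSpace ℝ V] [CompleteSpace V] {ι : H10 Ω ≃L[ℝ] V}

lemma normYs_nonneg (φ : SpaceX Ω T) : 0 ≤ normYs φ := Real.sqrt_nonneg _

lemma sqrt_integral_le_normYs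
    (hι : ∀ v w, inner ℝ (ι v) (ι w) = inner ℝ (grad v) (grad w)) (φ : SpaceX Ω T) :
    Real.sqrt (∫ s in Set.Ioo 0 T, ‖ι (φ s)‖ ^ 2) ≤ normYs φ := by
  refine Real.sqrt_le_sqrt ?_
  have h1 : ∫ s in Set.Ioo 0 T, ‖ι (φ s)‖ ^ 2
      ≤ ∫ s in Set.Ioo 0 T, (dualNorm (timeDeriv φ s) ^ 2 + ‖grad (φ s)‖ ^ 2) := by
    simp only [dualNorm_eq hι, ← norm_eq_norm_grad hι]
    refine integral_mono (integrable_norm_sq (memLp_equiv ι φ))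
      ((integrable_norm_sq (memLp_riesz ι (timeDeriv φ))).add
        (integrable_norm_sq (memLp_equiv ι φ))) fun s => ?_
    simp only
    linarith [sq_nonneg ‖riesz ι (timeDeriv φ s)‖]
  linarith [sq_nonneg ‖valueAt φ 0‖, sq_nonneg ‖valueAt φ T‖]

variable {f : L2Hneg Ω T} {N : ℕ} {t : ℕ → ℝ} {fn : ℕ → Hneg Ω}

/-- The pairing with the oscillation of the data is bounded already in terms of `‖φ‖_X`. -/
lemma exists_forall_integral_le_mul_normYs
    (hι : ∀ v w, inner ℝ (ι v) (ι w) = inner ℝ (grad v) (grad w)) :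
    ∃ M : ℝ, 0 ≤ M ∧ ∀ φ : SpaceX Ω T,
      ∫ s in Set.Ioo 0 T, (f s - sourceRec N t fn s) (φ s) ≤ M * normYs φ := by
  refine ⟨Real.sqrt (∫ s in Set.Ioo 0 T, ‖riesz ι (f s - sourceRec N t fn s)‖ ^ 2),
    Real.sqrt_nonneg _, fun φ => ?_⟩
  simp only [← inner_riesz_apply (ι := ι)]
  refine (integral_inner_le_sqrt_mul_sqrt
    ((riesz ι).comp_memLp' ((Lp.memLp f).sub memLp_sourceRec)) (memLp_equiv ι φ)).trans ?_
  exact mul_le_mul_of_nonneg_left (sqrt_integral_le_normYs hι φ) (Real.sqrt_nonneg _)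

lemma bddAbove_oscQuotients
    (hι : ∀ v w, inner ℝ (ι v) (ι w) = inner ℝ (grad v) (grad w)) :
    BddAbove (oscQuotients f N t fn) := by
  obtain ⟨M, hM, hle⟩ :=
    exists_forall_integral_le_mul_normYs (f := f) (N := N) (t := t) (fn := fn) hι
  refine ⟨M, ?_⟩
  rintro r ⟨φ, -, -, rfl⟩
  exact div_le_of_le_mul₀ (normYs_nonneg φ) hM (hle φ)

lemma neg_mem_SpaceY {φ : SpaceX Ω T} (h : φ ∈ SpaceY Ω T) : -φ ∈ SpaceY Ω T := by
  obtain ⟨w, hw⟩ := h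
  refine ⟨-w, fun ψ hψ => ?_⟩
  have e1 : ∫ s in Set.Ioo 0 T, deriv ψ s • toHneg (toL2 ((-φ : SpaceX Ω T) s))
      = -∫ s in Set.Ioo 0 T, deriv ψ s • toHneg (toL2 (φ s)) := by
    rw [← integral_neg]
    refine integral_congr_ae ((Lp.coeFn_neg φ).mono fun s hs => ?_)
    simp only [hs, Pi.neg_apply, map_neg, ← smul_neg]
    congr 1
    simp [toHneg]
  have e2 : ∫ s in Set.Ioo 0 T, ψ s • (-w : L2Hneg Ω T) s = -∫ s in Set.Ioo 0 T, ψ s • w s := by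
    rw [← integral_neg]
    refine integral_congr_ae ((Lp.coeFn_neg w).mono fun s hs => ?_)
    simp only [hs, Pi.neg_apply, smul_neg]
  rw [e1, e2, hw ψ hψ]

/-- The set of quotients is symmetric under `φ ↦ -φ`; if it is empty, its supremum is `0` by
convention. -/
lemma etaOsc_nonneg : 0 ≤ etaOsc f N t fn := by
  rcases (oscQuotients f N t fn).eq_empty_or_nonempty with h | ⟨r, φ, hφ, hφ0, rfl⟩
  · rw [etaOsc, h, Real.sSup_empty]
  · refine Real.sSup_nonneg' ?_
    rcases le_total 0 (∫ s in Set.Ioo 0 T, (f s - sourceRec N t fn s) (φ s)) with h | h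
    · exact ⟨_, ⟨φ, hφ, hφ0, rfl⟩, div_nonneg h (normYs_nonneg φ)⟩
    · refine ⟨_, ⟨-φ, neg_mem_SpaceY hφ, neg_ne_zero.2 hφ0, rfl⟩,
        div_nonneg ?_ (normYs_nonneg _)⟩
      have e : ∫ s in Set.Ioo 0 T, (f s - sourceRec N t fn s) ((-φ : SpaceX Ω T) s)
          = -∫ s in Set.Ioo 0 T, (f s - sourceRec N t fn s) (φ s) := by
        rw [← integral_neg]
        refine integral_congr_ae ((Lp.coeFn_neg φ).mono fun s hs => ?_)
        simp only [hs, Pi.neg_apply, map_neg]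
      rw [e]
      linarith

/-- The oscillation bounds the pairing with every element of `Y`, the zero element included. -/
lemma integral_le_etaOsc_mul_normYs
    (hι : ∀ v w, inner ℝ (ι v) (ι w) = inner ℝ (grad v) (grad w)) {φ : SpaceX Ω T}
    (hφ : φ ∈ SpaceY Ω T) :
    ∫ s in Set.Ioo 0 T, (f s - sourceRec N t fn s) (φ s) ≤ etaOsc f N t fn * normYs φ := by
  obtain ⟨M, hM, hle⟩ :=
    exists_forall_integral_le_mul_normYs (f := f) (N := N) (t := t) (fn := fn) hι
  rcases (normYs_nonneg φ).eq_or_lt with h | h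
  · have := hle φ
    rwa [← h, mul_zero] at this ⊢
  · by_cases h0 : φ = 0
    · have e : ∫ s in Set.Ioo 0 T, (f s - sourceRec N t fn s) (φ s) = 0 := by
        refine integral_eq_zero_of_ae ?_
        rw [h0]
        filter_upwards [Lp.coeFn_zero (H10 Ω) 2 (volume.restrict (Set.Ioo 0 T))] with s hs
        simp only [hs, Pi.zero_apply, map_zero]
      rw [e]
      exact mul_nonneg etaOsc_nonneg h.le
    · rw [← div_le_iff₀ h]
      exact le_csSup (bddAbove_oscQuotients hι) ⟨φ, hφ, h0, rfl⟩

lemma integral_riesz_le_etaOsc_mul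
    (hι : ∀ v w, inner ℝ (ι v) (ι w) = inner ℝ (grad v) (grad w)) (hT : 0 < T) {φ : ℝ → V}
    (hφ : ContDiff ℝ 1 φ) :
    ∫ s in Set.Ioo 0 T, inner ℝ (riesz ι (f s - sourceRec N t fn s)) (φ s)
      ≤ etaOsc f N t fn * normYs (smoothX ι T hφ) := by
  refine le_of_eq_of_le (integral_congr_ae ?_)
    (integral_le_etaOsc_mul_normYs hι (smoothX_mem ι hT hφ))
  filter_upwards [smoothX_ae ι T hφ] with s hs
  rw [hs, inner_riesz]

/-- The trace `u(T)` is a limit in `L²(Ω)` of elements of `H¹₀(Ω)`. -/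
lemma valueAt_mem_closure_range (ι : H10 Ω ≃L[ℝ] V) (hT : 0 < T) {u : SpaceX Ω T}
    (hu : u ∈ SpaceY Ω T) : valueAt u T ∈ closure (Set.range (embL2 ι)) := by
  obtain ⟨hc, hae⟩ := valueAt_spec_of_mem ι hT hu
  rw [Metric.mem_closure_iff_infDist_zero (Set.range_nonempty _)]
  refine eqOn_Icc_of_ae_eq_Ioo hT (f := fun s => Metric.infDist (valueAt u s)
    (Set.range (embL2 ι))) (g := fun _ => (0 : ℝ))
    ((Metric.continuous_infDist_pt _).comp_continuousOn hc) continuousOn_const ?_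
    (Set.right_mem_Icc.2 hT.le)
  filter_upwards [hae] with s hs
  exact Metric.infDist_zero_of_mem ⟨ι (u s), by rw [embL2_apply, hs]⟩

lemma sub_mem_closure_range {W H : Type*} [NormedAddCommGroup W] [NormedSpace ℝ W]
    [NormedAddCommGroup H] [NormedSpace ℝ H] (J : W →L[ℝ] H) {h : H}
    (hh : h ∈ closure (Set.range J)) (x : W) : h - J x ∈ closure (Set.range J) := by
  have := (LinearMap.range J.toLinearMap).topologicalClosure.sub_mem (x := h) (y := J x) hh
    (subset_closure ⟨x, rfl⟩)
  exact this

variable {un : ℕ → H10 Ω} {u : SpaceX Ω T}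

/-- The upper bound for the error: the right-hand side of `integral_error_identity` is bounded by
the time-symmetric norm of `φ`, which is the norm of the backward heat operator and the trace at
the final time. -/
lemma energyNorm_le
    (hι : ∀ v w, inner ℝ (ι v) (ι w) = inner ℝ (grad v) (grad w)) (hT : 0 < T)
    (hu : IsWeakSolution f (toL2 (un 0)) u) (ht : IsTimePartition T N t)
    (hun : IsImplicitEuler N t fn un) :
    energyNorm T (fun s => u s - averageRec N t un s)
        (valueAt u T - toL2 (averageRec N t un T))
      ≤ 1 / 2 * etaJ T N t un + etaOsc f N t fn := by
  have hJ0 : 0 ≤ etaJ T N t un := Real.sqrt_nonneg _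
  have hO0 : 0 ≤ etaOsc f N t fn := etaOsc_nonneg
  unfold energyNorm
  simp only [← norm_eq_norm_grad hι]
  refine sqrt_half_add_integral_le_of_heatOp (J := embL2 ι) hT
    ((ι : H10 Ω →L[ℝ] V).comp_memLp' ((Lp.memLp u).sub memLp_averageRec)) ?_
    (by positivity) fun φ hφ => ?_
  · rw [← embL2_apply (ι := ι)]
    exact sub_mem_closure_range _ (valueAt_mem_closure_range ι hT hu.mem_Y) _
  · rw [← (normYs_smoothX_eq_heatOp hι hT hφ).2, add_mul]
    refine (integral_error_identity hι hT hu ht hun hφ).trans_le ?_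
    rw [add_comm]
    refine add_le_add ?_ (integral_riesz_le_etaOsc_mul hι hT hφ)
    rw [mul_assoc]
    refine mul_le_mul_of_nonneg_left ?_ (by norm_num)
    refine (integral_inner_le_sqrt_mul_sqrt
      ((ι : H10 Ω →L[ℝ] V).comp_memLp' (memLp_constRec.sub memLp_affineRec))
      (memLp_heatOp _ hφ T)).trans ?_
    refine mul_le_mul (le_of_eq ?_) ?_ (Real.sqrt_nonneg _) hJ0
    · unfold etaJ normX
      simp only [← norm_eq_norm_grad hι]
      rfl
    · rw [(normYs_smoothX_eq_heatOp hι hT hφ).1]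
      refine Real.sqrt_le_sqrt ?_
      linarith [sq_nonneg ‖embL2 ι (φ 0)‖]

/-- The Cauchy-Schwarz inequality in the plane, with weights. -/
lemma mul_add_mul_le_sqrt_half_mul_sqrt (a b p q : ℝ) :
    a * b + p * q ≤ Real.sqrt (1 / 2 * p ^ 2 + a ^ 2) * Real.sqrt (b ^ 2 + 2 * q ^ 2) := by
  rw [← Real.sqrt_mul (by positivity)]
  refine Real.le_sqrt_of_sq_le ?_
  nlinarith [sq_nonneg (2 * a * q - p * b)]

/-- The lower bound: `integral_error_identity` is solved for the jump term, paired with the forward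
heat operator on functions vanishing at time `0`, for which that pairing alone recovers the
time-symmetric norm. -/
lemma etaJ_le
    (hι : ∀ v w, inner ℝ (ι v) (ι w) = inner ℝ (grad v) (grad w)) (hT : 0 < T)
    (hu : IsWeakSolution f (toL2 (un 0)) u) (ht : IsTimePartition T N t)
    (hun : IsImplicitEuler N t fn un) :
    1 / 2 * etaJ T N t un
      ≤ energyNorm T (fun s => u s - averageRec N t un s)
          (valueAt u T - toL2 (averageRec N t un T)) + etaOsc f N t fn := by
  set e := energyNorm T (fun s => u s - averageRec N t un s)
          (valueAt u T - toL2 (averageRec N t un T)) with he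
  have he0 : 0 ≤ e := Real.sqrt_nonneg _
  have hO0 : 0 ≤ etaOsc f N t fn := etaOsc_nonneg
  have hmain : etaJ T N t un ≤ 2 * (e + etaOsc f N t fn) := by
    unfold etaJ normX
    simp only [← norm_eq_norm_grad hι]
    refine sqrt_integral_le_of_heatOp (J := embL2 ι) hT (Or.inl ⟨rfl, rfl⟩)
      ((ι : H10 Ω →L[ℝ] V).comp_memLp' (memLp_constRec.sub memLp_affineRec))
      (by positivity) fun φ hφ hφ0 => ?_
    -- The forward problem is tested with `φ`, the oscillation with `-φ`.
    have hψ : ContDiff ℝ 1 fun s => (-1 : ℝ) • φ s := hφ.const_smul _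
    have h1 := integral_error_identity hι hT hu ht hun hψ
    have hop : ∀ σ s, heatOp (embL2 ι) σ (fun s => (-1 : ℝ) • φ s) s
        = -heatOp (embL2 ι) σ φ s := fun σ s => by
      rw [heatOp_const_smul σ (-1) hφ, neg_one_smul]
    have h2 := integral_riesz_le_etaOsc_mul (f := f) (N := N) (t := t) (fn := fn) hι hT hψ
    have hn1 := (normYs_smoothX_eq_heatOp hι hT hψ).1
    have hn2 := (normYs_smoothX_eq_heatOp hι hT hψ).2
    generalize normYs (smoothX ι T hψ) = S at h2 hn1 hn2
    simp only [hop, norm_neg, hφ0, smul_zero, map_zero, norm_zero] at hn1 hn2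
    simp only [hop, inner_neg_right, integral_neg] at h1
    simp only [neg_one_smul, map_neg, norm_neg, inner_neg_right] at h1 hn2
    simp only [neg_one_smul, inner_neg_right, integral_neg] at h2
    have hcs : ∫ s in Set.Ioo 0 T,
          inner ℝ (ι (u s - averageRec N t un s)) (heatOp (embL2 ι) (-1) φ s)
        ≤ Real.sqrt (∫ s in Set.Ioo 0 T, ‖ι (u s - averageRec N t un s)‖ ^ 2)
          * Real.sqrt (∫ s in Set.Ioo 0 T, ‖heatOp (embL2 ι) (-1) φ s‖ ^ 2) :=
      integral_inner_le_sqrt_mul_sqrt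
        ((ι : H10 Ω →L[ℝ] V).comp_memLp' ((Lp.memLp u).sub memLp_averageRec))
        (memLp_heatOp (J := embL2 ι) (-1) hφ T)
    have hcs_end := real_inner_le_norm (valueAt u T - toL2 (averageRec N t un T)) (embL2 ι (φ T))
    have hpair := mul_add_mul_le_sqrt_half_mul_sqrt
      (Real.sqrt (∫ s in Set.Ioo 0 T, ‖ι (u s - averageRec N t un s)‖ ^ 2))
      (Real.sqrt (∫ s in Set.Ioo 0 T, ‖heatOp (embL2 ι) (-1) φ s‖ ^ 2))
      ‖valueAt u T - toL2 (averageRec N t un T)‖ ‖embL2 ι (φ T)‖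
    rw [Real.sq_sqrt (integral_nonneg fun _ => sq_nonneg _),
      Real.sq_sqrt (integral_nonneg fun _ => sq_nonneg _)] at hpair
    have he' : e = Real.sqrt (1 / 2 * ‖valueAt u T - toL2 (averageRec N t un T)‖ ^ 2
        + ∫ s in Set.Ioo 0 T, ‖ι (u s - averageRec N t un s)‖ ^ 2) := by
      simp only [he, energyNorm, norm_eq_norm_grad hι]
    rw [← he', ← hn2, hn1, zero_pow two_ne_zero, mul_zero, add_zero] at hpair
    rw [hn1, zero_pow two_ne_zero, mul_zero, add_zero] at h2
    rw [integral_neg] at h1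
    change ∫ s in Set.Ioo 0 T,
      inner ℝ (ι (constRec N t un s - affineRec N t un s)) (heatOp (embL2 ι) 1 φ s) ≤ _
    linarith
  linarith

end Estimates

end HeatEuler

theorem mainTheorem2 {d : ℕ} (hd : 1 ≤ d) (Ω : Set (EuclideanSpace ℝ (Fin d)))
    (hΩ : IsOpen Ω) (hΩb : Bornology.IsBounded Ω) (T : ℝ) (hT : 0 < T)
    (f : L2Hneg Ω T) (u₀ : H10 Ω) (u : SpaceX Ω T)
    (hu : IsWeakSolution f (toL2 u₀) u)
    (N : ℕ) (t : ℕ → ℝ) (ht : IsTimePartition T N t)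
    (fn : ℕ → Hneg Ω) (un : ℕ → H10 Ω) (hun₀ : un 0 = u₀)
    (hun : IsImplicitEuler N t fn un) :
    BddAbove (oscQuotients f N t fn) ∧
    energyNorm T (fun s => u s - averageRec N t un s)
        (valueAt u T - toL2 (averageRec N t un T))
      ≤ 1 / 2 * etaJ T N t un + etaOsc f N t fn ∧
    1 / 2 * etaJ T N t un
      ≤ energyNorm T (fun s => u s - averageRec N t un s)
          (valueAt u T - toL2 (averageRec N t un T))
        + etaOsc f N t fn := by
  obtain ⟨_, ι, hι⟩ := exists_gradEquiv (Ω := Ω) hd hΩb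
  subst hun₀
  exact ⟨bddAbove_oscQuotients hι, energyNorm_le hι hT hu ht hun, etaJ_le hι hT hu ht hun⟩
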